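/- Let $N=\{1,\dots,n\}$ be a set of $n$ agents and $M$ a finite set of $m$ indivisible goods. Each agent $i$ has an additive valuation: she has a value $v_i(g)\in\mathbb{R}_{\ge 0}$ for every good $g$, and $v_i(S)=\sum_{g\in S}v_i(g)$ for every $S\subseteq M$. An allocation is a tuple $(X_1,\dots,X_n)$ of pairwise disjoint subsets of $M$ with $\bigcup_i X_i=M$; it is $\frac23$-EFX if $v_i(X_i)\ge \frac23\, v_i(X_j\setminus\{g\})$ for all agents $i\ne j$ and every good $g\in X_j$. **Theorem.** Every instance with at most $8$ agents (that is, $1\le n\le 8$, with any number $m\ge 0$ of goods and any additive valuations) has a $\frac23$-EFX allocation. Moreover, there is a polynomial-time algorithm that computes a $\frac23$-EFX allocation for every such instance: a single program of a random access machine with logarithmic cost which, given $n$, $m$ and the values $v_i(g)\in\mathbb{Q}_{\ge 0}$ (numerators and denominators written in binary), outputs a $\frac23$-EFX allocation in time bounded by a fixed polynomial in the bit length of the input. -/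

import Mathlib

open scoped NNRat

namespace FairDivision

/-- The value `v_i(S) = ∑_{g ∈ S} v_i(g)` that agent `i` has for the bundle `S`, under the additive
valuations given by the values `v i g` of single goods. -/
def bundleValue {N M : Type*} (v : N → M → ℝ) (i : N) (S : Finset M) : ℝ :=
  ∑ g ∈ S, v i g

/-- A partial allocation: the bundles of different agents are disjoint. -/
def IsPartialAllocation {N M : Type*} (X : N → Finset M) : Prop :=
  ∀ i j, i ≠ j → Disjoint (X i) (X j)

/-- A (full) allocation: a partial allocation in which every good is given to some agent. -/
def IsAllocation {N M : Type*} (X : N → Finset M) : Prop :=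
  IsPartialAllocation X ∧ ∀ g, ∃ i, g ∈ X i

/-- Agent `i` is `α`-EFkX towards agent `j` : the value of agent `i` for her own bundle is at least
`α` times her value for the bundle of `j` after the removal of any `k` goods. -/
def IsEFkXTowards {N M : Type*} [DecidableEq M] (α : ℝ) (k : ℕ) (v : N → M → ℝ)
    (X : N → Finset M) (i j : N) : Prop :=
  ∀ Y ⊆ X j, Y.card = k → α * bundleValue v i (X j \ Y) ≤ bundleValue v i (X i)

/-- `X` is `α`-EFkX : every agent is `α`-EFkX towards any other agent. -/
def IsEFkX {N M : Type*} [DecidableEq M] (α : ℝ) (k : ℕ) (v : N → M → ℝ)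
    (X : N → Finset M) : Prop :=
  ∀ i j, i ≠ j → IsEFkXTowards α k v X i j

/-- `α`-EFX is `α`-EFkX for `k = 1`. -/
def IsEFX {N M : Type*} [DecidableEq M] (α : ℝ) (v : N → M → ℝ) (X : N → Finset M) : Prop :=
  IsEFkX α 1 v X

end FairDivision

/-! A random access machine with logarithmic cost. Its store consists of registers and of unbounded
arrays that are addressed indirectly, all holding natural numbers; a program mentions finitely many
registers and arrays. Every operation is charged one unit plus the bit length of the number it
yields, so a run of cost `t` never handles a number of more than `t` bits. -/
namespace RAM

/-- A state of the machine: the contents of the registers, and the entry of each array at each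
address. -/
structure State where
  reg : ℕ → ℕ
  arr : ℕ → ℕ → ℕ

/-- Expressions: constants, the contents of a register, the entry of array `k` at a computed
address, sum, truncated difference, product and integer quotient (with `a / 0 = 0`). -/
inductive Expr where
  | const (c : ℕ)
  | reg (r : ℕ)
  | get (k : ℕ) (e : Expr)
  | add (e₁ e₂ : Expr)
  | sub (e₁ e₂ : Expr)
  | mul (e₁ e₂ : Expr)
  | div (e₁ e₂ : Expr)

/-- The value of an expression in a state. -/
def Expr.val (s : State) : Expr → ℕ
  | .const c => c
  | .reg r => s.reg r
  | .get k e => s.arr k (e.val s)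
  | .add e₁ e₂ => e₁.val s + e₂.val s
  | .sub e₁ e₂ => e₁.val s - e₂.val s
  | .mul e₁ e₂ => e₁.val s * e₂.val s
  | .div e₁ e₂ => e₁.val s / e₂.val s

/-- The cost of evaluating an expression: one unit plus the bit length of the value, for every
subexpression. -/
def Expr.cost (s : State) : Expr → ℕ
  | .const c => 1 + Nat.size c
  | .reg r => 1 + Nat.size (s.reg r)
  | .get k e => e.cost s + (1 + Nat.size (s.arr k (e.val s)))
  | .add e₁ e₂ => e₁.cost s + e₂.cost s + (1 + Nat.size (e₁.val s + e₂.val s))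
  | .sub e₁ e₂ => e₁.cost s + e₂.cost s + (1 + Nat.size (e₁.val s - e₂.val s))
  | .mul e₁ e₂ => e₁.cost s + e₂.cost s + (1 + Nat.size (e₁.val s * e₂.val s))
  | .div e₁ e₂ => e₁.cost s + e₂.cost s + (1 + Nat.size (e₁.val s / e₂.val s))

/-- Programs: `assign r e` stores the value of `e` in register `r`, and `put k e₁ e₂` stores the
value of `e₂` in array `k` at the address given by `e₁`. Tests ask whether a value is nonzero. -/
inductive Cmd where
  | skip
  | assign (r : ℕ) (e : Expr)
  | put (k : ℕ) (e₁ e₂ : Expr)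
  | seq (c₁ c₂ : Cmd)
  | ite (e : Expr) (c₁ c₂ : Cmd)
  | loop (e : Expr) (c : Cmd)

/-- The state after storing `x` in register `r`. -/
def State.setReg (s : State) (r x : ℕ) : State :=
  { s with reg := Function.update s.reg r x }

/-- The state after storing `x` in array `k` at address `a`. -/
def State.setArr (s : State) (k a x : ℕ) : State :=
  { s with arr := Function.update s.arr k (Function.update (s.arr k) a x) }

/-- `Exec c s s' t` : started in state `s`, the program `c` halts in state `s'`, at total
cost `t`. -/
inductive Exec : Cmd → State → State → ℕ → Prop where
  | skip (s : State) : Exec .skip s s 1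
  | assign (r : ℕ) (e : Expr) (s : State) :
      Exec (.assign r e) s (s.setReg r (e.val s)) (1 + e.cost s)
  | put (k : ℕ) (e₁ e₂ : Expr) (s : State) :
      Exec (.put k e₁ e₂) s (s.setArr k (e₁.val s) (e₂.val s)) (1 + e₁.cost s + e₂.cost s)
  | seq {c₁ c₂ : Cmd} {s s₁ s₂ : State} {t₁ t₂ : ℕ} :
      Exec c₁ s s₁ t₁ → Exec c₂ s₁ s₂ t₂ → Exec (.seq c₁ c₂) s s₂ (t₁ + t₂)
  | iteTrue {e : Expr} {c₁ c₂ : Cmd} {s s' : State} {t : ℕ} :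
      e.val s ≠ 0 → Exec c₁ s s' t → Exec (.ite e c₁ c₂) s s' (1 + e.cost s + t)
  | iteFalse {e : Expr} {c₁ c₂ : Cmd} {s s' : State} {t : ℕ} :
      e.val s = 0 → Exec c₂ s s' t → Exec (.ite e c₁ c₂) s s' (1 + e.cost s + t)
  | loopTrue {e : Expr} {c : Cmd} {s s₁ s₂ : State} {t₁ t₂ : ℕ} :
      e.val s ≠ 0 → Exec c s s₁ t₁ → Exec (.loop e c) s₁ s₂ t₂ →
      Exec (.loop e c) s s₂ (1 + e.cost s + t₁ + t₂)
  | loopFalse {e : Expr} {c : Cmd} {s : State} :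
      e.val s = 0 → Exec (.loop e c) s s (1 + e.cost s)

/-- The machine is deterministic: the final state and the cost of a halting run are determined by
the program and the initial state. -/
theorem Exec.unique {c : Cmd} {s s₁ s₂ : State} {t₁ t₂ : ℕ}
    (h₁ : Exec c s s₁ t₁) (h₂ : Exec c s s₂ t₂) : s₁ = s₂ ∧ t₁ = t₂ := by
  induction h₁ generalizing s₂ t₂ with
  | skip s => cases h₂; exact ⟨rfl, rfl⟩
  | assign r e s => cases h₂; exact ⟨rfl, rfl⟩
  | put k e₁ e₂ s => cases h₂; exact ⟨rfl, rfl⟩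
  | seq _ _ ih₁ ih₂ =>
    cases h₂ with
    | seq a b =>
      obtain ⟨rfl, rfl⟩ := ih₁ a
      obtain ⟨rfl, rfl⟩ := ih₂ b
      exact ⟨rfl, rfl⟩
  | iteTrue h _ ih =>
    cases h₂ with
    | iteTrue _ a => obtain ⟨rfl, rfl⟩ := ih a; exact ⟨rfl, rfl⟩
    | iteFalse h' _ => exact absurd h' h
  | iteFalse h _ ih =>
    cases h₂ with
    | iteTrue h' _ => exact absurd h h'
    | iteFalse _ a => obtain ⟨rfl, rfl⟩ := ih a; exact ⟨rfl, rfl⟩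
  | loopTrue h _ _ ih₁ ih₂ =>
    cases h₂ with
    | loopTrue _ a b =>
      obtain ⟨rfl, rfl⟩ := ih₁ a
      obtain ⟨rfl, rfl⟩ := ih₂ b
      exact ⟨rfl, rfl⟩
    | loopFalse h' => exact absurd h' h
  | loopFalse h =>
    cases h₂ with
    | loopTrue h' _ _ => exact absurd h h'
    | loopFalse _ => exact ⟨rfl, rfl⟩

end RAM

namespace FairDivision

/-- The bit length of an instance with `n` agents, `m` goods and rational values: the total length
of the binary representations of `n`, of `m`, and of all numerators and denominators. -/
def instanceSize {n m : ℕ} (v : Fin n → Fin m → ℚ≥0) : ℕ :=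
  Nat.size n + Nat.size m + ∑ i, ∑ g, (Nat.size (v i g).num + Nat.size (v i g).den)

/-- The initial state of the machine on an instance: registers `0` and `1` hold `n` and `m`, and at
address `i * m + g` the arrays `0` and `1` hold the numerator and the denominator of the value
`v i g`; everything else is `0`. -/
def initialState {n m : ℕ} (v : Fin n → Fin m → ℚ≥0) : RAM.State where
  reg := fun r => if r = 0 then n else if r = 1 then m else 0
  arr := fun k a =>
    if h : a < n * m then
      if k = 0 then (v (Fin.divNat ⟨a, h⟩) (Fin.modNat ⟨a, h⟩)).num
      else if k = 1 then (v (Fin.divNat ⟨a, h⟩) (Fin.modNat ⟨a, h⟩)).den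
      else 0
    else 0

/-- A final state encodes the allocation `X` if, for every good `g`, array `2` holds at address `g`
the index of the agent who receives `g`. -/
def Encodes {n m : ℕ} (s : RAM.State) (X : Fin n → Finset (Fin m)) : Prop :=
  ∀ i g, g ∈ X i ↔ s.arr 2 g = i

end FairDivision

/-!
Existence. A pair of goods counts with one and a half times its value: this is the `level` of a
bundle of at most two goods. Among the allocations of single goods and pairs in which nobody values
a good of a pair at more than her own level (`IsPairAllocation`), take one of maximum total level
(`IsOptimal`). Its envy graph in terms of levels is acyclic, and along a path that starts at a
source (`IsSource`) bundles can be shifted so that the bundle of the source becomes available to the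
last agent. Optimality therefore bounds every pair of goods from a source and the pool by the level
of each agent reached from this source (`IsOptimal.pair_le`).

A good is critical for an agent if she values it at more than half of her bundle. An unallocated
good that is critical for at most one agent can always be added by envy-cycle elimination, without
loss to anybody (`exists_permuteAdd`), so the obstacles are the contested goods, those that are
critical for two agents. An agent with a pair has no critical good and other agents have at most
one, so with `c` contested goods and `p` pairs, `2 c + p` is at most the number of agents
(`IsOptimal.card_contested`). As there are at most eight agents and sources have pairs, there are at
most three contested goods, and these can be given to the sources: one each if there are enough
sources (`IsOptimal.isNearSeed_attach_of_injOn`), and otherwise by counting in two tight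
situations (`IsOptimal.exists_isNearSeed_of_two_sources`,
`IsOptimal.exists_isNearSeed_of_unique_source`). At most eight critical goods then remain, and they
are added one by one. The result is a seed (`IsSeed`): a partial allocation of at most 27 goods
without critical unallocated goods. From a seed, envy-cycle elimination allocates all remaining
goods. Zero values are treated by a perturbation (`exists_isSeed`).

Algorithm. The seed is found by exhaustive search, for there are only polynomially many ways to
allocate at most 27 goods to at most eight agents. After that, allocating one more good permutes the
bundles and changes the owner of a single good; this is again found by exhaustive search. Both
searches are the same program: a candidate renames the owners and then changes the owners of at most
27 goods (`candidate`), and it is accepted if it passes the test `IsGood`. All values are multiplied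
by the product of the denominators, so that the test uses natural numbers of polynomial length.
Running times are bounded by counting elementary steps under a uniform bound for the length of all
numbers in the store (`RAM.Runs`).
-/

namespace FairDivision

/-! ### Envy graphs -/

section EnvyGraph

variable {N : Type*}

/-- The envy relation of a table `w`, in which `w k j` is what agent `k` thinks of the bundle of
agent `j`. -/
def Envies (w : N → N → ℝ) (k j : N) : Prop := w k k < w k j

/-- A path can be pruned so that it never comes back to its first vertex. -/
theorem reflTransGen_erase [DecidableEq N] {r : N → N → Prop} {A : Finset N} {a i : N}
    (h : Relation.ReflTransGen (fun x y => r x y ∧ y ∈ A) a i) :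
    Relation.ReflTransGen (fun x y => r x y ∧ y ∈ A.erase a) a i := by
  induction h with
  | refl => exact .refl
  | @tail b c _ hbc ih =>
    by_cases hc : c = a
    · exact hc ▸ .refl
    · exact ih.tail ⟨hbc.1, Finset.mem_erase.2 ⟨hc, hbc.2⟩⟩

/-- Bundles can be shifted along a path of the envy graph: the last agent gives up her bundle, the
bundle of the first agent becomes free, and nobody else is worse off. -/
theorem exists_perm_of_reflTransGen_envies [Fintype N] [DecidableEq N] {w : N → N → ℝ} {s i : N}
    (h : Relation.ReflTransGen (Envies w) s i) :
    ∃ π : Equiv.Perm N, π i = s ∧ ∀ k, k ≠ i → w k k ≤ w k (π k) := by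
  suffices key : ∀ (A : Finset N) (s : N), s ∉ A →
      Relation.ReflTransGen (fun x y => Envies w x y ∧ y ∈ A) s i →
      ∃ π : Equiv.Perm N, π i = s ∧ (∀ k, k ≠ i → w k k ≤ w k (π k)) ∧
        ∀ k, k ∉ A → k ≠ s → π k = k by
    have h' : Relation.ReflTransGen (fun x y => Envies w x y ∧ y ∈ Finset.univ) s i :=
      h.lift id fun x y hxy => ⟨hxy, Finset.mem_univ y⟩
    obtain ⟨π, h1, h2, -⟩ := key _ s (Finset.notMem_erase s Finset.univ) (reflTransGen_erase h')
    exact ⟨π, h1, h2⟩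
  intro A
  induction A using Finset.strongInduction with
  | H A ih =>
    intro s hs h
    rcases Relation.ReflTransGen.cases_head h with rfl | ⟨s', ⟨hss', hs'A⟩, hs'⟩
    · exact ⟨1, rfl, fun k _ => le_rfl, fun k _ _ => rfl⟩
    · obtain ⟨π, h1, h2, h3⟩ := ih (A.erase s') (Finset.erase_ssubset hs'A) s'
        (Finset.notMem_erase _ _) (reflTransGen_erase hs')
      have hne : s ≠ s' := fun e => hs (e ▸ hs'A)
      have hsπ : π s = s := h3 s (fun hm => hs (Finset.mem_of_mem_erase hm)) hne
      refine ⟨Equiv.swap s s' * π, by simp [h1], fun k hk => ?_, fun k hkA hks => ?_⟩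
      · by_cases hks : k = s
        · subst hks
          simpa [hsπ] using le_of_lt hss'
        · have e1 : π k ≠ s := fun e => hks (π.injective (e.trans hsπ.symm))
          have e2 : π k ≠ s' := fun e => hk (π.injective (e.trans h1.symm))
          simpa [Equiv.swap_apply_of_ne_of_ne e1 e2] using h2 k hk
      · have hks' : k ≠ s' := fun e => hkA (e ▸ hs'A)
        have : π k = k := h3 k (fun hm => hkA (Finset.mem_of_mem_erase hm)) hks'
        simp [this, Equiv.swap_apply_of_ne_of_ne hks hks']

/-- If no reassignment of the bundles is a Pareto improvement, then every agent can be reached in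
the envy graph from an agent whom nobody envies. -/
theorem exists_source_reflTransGen [Finite N] {w : N → N → ℝ}
    (hw : ∀ π : Equiv.Perm N, (∀ k, w k k ≤ w k (π k)) → ∀ k, w k (π k) ≤ w k k) (i : N) :
    ∃ t, Relation.ReflTransGen (Envies w) t i ∧ ∀ k, ¬ Envies w k t := by
  classical
  have := Fintype.ofFinite N
  have hirr : ∀ k, ¬ Relation.TransGen (Envies w) k k := by
    intro k hk
    obtain ⟨k', hkk', hk'⟩ := Relation.TransGen.head'_iff.1 hk
    obtain ⟨π, h1, h2⟩ := exists_perm_of_reflTransGen_envies hk'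
    have hlt : w k k < w k (π k) := by rw [h1]; exact hkk'
    refine absurd (hw π (fun j => ?_) k) (not_le.2 hlt)
    by_cases hj : j = k
    · exact hj ▸ hlt.le
    · exact h2 j hj
  have : Std.Irrefl (Relation.TransGen (Envies w)) := ⟨hirr⟩
  have wf : WellFounded (Relation.TransGen (Envies w)) := Finite.wellFounded_of_trans_of_irrefl _
  obtain ⟨t, ht, hmin⟩ :=
    wf.has_min {t | Relation.ReflTransGen (Envies w) t i} ⟨i, Relation.ReflTransGen.refl⟩
  exact ⟨t, ht, fun k hk => hmin k (Relation.ReflTransGen.head hk ht) (.single hk)⟩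

end EnvyGraph

/-! ### Adding a good with at most one critical agent -/

section Extend

variable {N M : Type*}

theorem bundleValue_nonneg {v : N → M → ℝ} (hv : ∀ i g, 0 ≤ v i g) (k : N) (S : Finset M) :
    0 ≤ bundleValue v k S :=
  Finset.sum_nonneg fun g _ => hv k g

theorem bundleValue_mono {v : N → M → ℝ} (hv : ∀ i g, 0 ≤ v i g) (k : N) {S T : Finset M}
    (h : S ⊆ T) : bundleValue v k S ≤ bundleValue v k T :=
  Finset.sum_le_sum_of_subset_of_nonneg h fun g _ _ => hv k g

theorem bundleValue_union_le [DecidableEq M] {v : N → M → ℝ} (hv : ∀ i g, 0 ≤ v i g) (k : N)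
    (S T : Finset M) : bundleValue v k (S ∪ T) ≤ bundleValue v k S + bundleValue v k T := by
  have := Finset.sum_union_inter (s₁ := S) (s₂ := T) (f := v k)
  have h0 := bundleValue_nonneg hv k (S ∩ T)
  unfold bundleValue at *
  linarith

theorem bundleValue_insert_le [DecidableEq M] {v : N → M → ℝ} (hv : ∀ i g, 0 ≤ v i g) (k : N)
    (g : M) (S : Finset M) : bundleValue v k (insert g S) ≤ v k g + bundleValue v k S := by
  have := bundleValue_union_le hv k {g} S
  rwa [← Finset.insert_eq, bundleValue, bundleValue, Finset.sum_singleton] at this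

/-- The condition `2/3`-EFX, with the denominator cleared. -/
def IsTwoThirdsEFX [DecidableEq M] (v : N → M → ℝ) (X : N → Finset M) : Prop :=
  ∀ k j, k ≠ j → ∀ g ∈ X j, 2 * bundleValue v k (X j \ {g}) ≤ 3 * bundleValue v k (X k)

theorem isEFX_two_thirds_iff [DecidableEq M] {v : N → M → ℝ} {X : N → Finset M} :
    IsEFX (2 / 3) v X ↔ IsTwoThirdsEFX v X := by
  constructor
  · intro h k j hkj g hg
    have := h k j hkj {g} (by simpa using hg) (by simp)
    linarith
  · intro h k j hkj Y hY hc
    obtain ⟨g, rfl⟩ := Finset.card_eq_one.1 hc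
    have := h k j hkj g (by simpa using hY)
    linarith

/-- The good `g` is critical for agent `k` if she values it at more than half of her bundle. -/
def IsCritical (v : N → M → ℝ) (X : N → Finset M) (g : M) (k : N) : Prop :=
  bundleValue v k (X k) < 2 * v k g

/-- The allocation obtained from `X` when the bundles are reassigned by `π` and then the good `g` is
added to the new bundle of agent `s`. -/
def permuteAdd [DecidableEq N] [DecidableEq M] (X : N → Finset M) (π : Equiv.Perm N) (s : N)
    (g : M) : N → Finset M :=
  Function.update (X ∘ π) s (insert g (X (π s)))

theorem subset_permuteAdd [DecidableEq N] [DecidableEq M] (X : N → Finset M) (π : Equiv.Perm N)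
    (s : N) (g : M) (k : N) : X (π k) ⊆ permuteAdd X π s g k := by
  unfold permuteAdd
  by_cases h : k = s
  · subst h; simp
  · simp [h]

theorem mem_permuteAdd [DecidableEq N] [DecidableEq M] {X : N → Finset M} {π : Equiv.Perm N}
    {s k : N} {g x : M} : x ∈ permuteAdd X π s g k ↔ x ∈ X (π k) ∨ (k = s ∧ x = g) := by
  unfold permuteAdd
  by_cases h : k = s
  · subst h
    rw [Function.update_self, Finset.mem_insert]
    tauto
  · simp [h]

theorem isPartialAllocation_permuteAdd [DecidableEq N] [DecidableEq M] {X : N → Finset M}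
    (hX : IsPartialAllocation X) {g : M} (hg : ∀ j, g ∉ X j) (π : Equiv.Perm N) (s : N) :
    IsPartialAllocation (permuteAdd X π s g) := by
  intro i j hij
  rw [Finset.disjoint_left]
  intro x hx hx'
  rcases mem_permuteAdd.1 hx with h | ⟨rfl, rfl⟩ <;> rcases mem_permuteAdd.1 hx' with h' | ⟨h1, h2⟩
  · exact Finset.disjoint_left.1 (hX _ _ (π.injective.ne hij)) h h'
  · exact hg _ (h2 ▸ h)
  · exact hg _ h'
  · exact hij h1.symm

variable [Fintype N] [DecidableEq N] [DecidableEq M]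

/-- Envy-cycle elimination also places a good `g` that is critical for one agent `i`. After Pareto
improvements there is an agent whom nobody envies and from whom `i` can be reached in the envy
graph. She receives `g`, unless this is too much for `i`; in that case the bundles are shifted along
the path and `i` receives the bundle at its start together with `g`. -/
theorem exists_permuteAdd {v : N → M → ℝ} (hv : ∀ i g, 0 ≤ v i g) {X : N → Finset M}
    (hEFX : IsTwoThirdsEFX v X) (hN : Nonempty N) {g : M}
    (hcrit : ∀ k k', IsCritical v X g k → IsCritical v X g k' → k = k') :
    ∃ (π : Equiv.Perm N) (s : N), IsTwoThirdsEFX v (permuteAdd X π s g) ∧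
      ∀ k, bundleValue v k (X k) ≤ bundleValue v k (permuteAdd X π s g k) := by
  classical
  -- a Pareto improvement of maximum total value among the reassignments of the bundles
  obtain ⟨ρ, hρ, hmax⟩ := Finset.exists_max_image
    (Finset.univ.filter fun ρ : Equiv.Perm N =>
      ∀ k, bundleValue v k (X k) ≤ bundleValue v k (X (ρ k)))
    (fun ρ => ∑ k, bundleValue v k (X (ρ k))) ⟨1, by simp⟩
  simp only [Finset.mem_filter, Finset.mem_univ, true_and] at hρ hmax
  set w : N → N → ℝ := fun k j => bundleValue v k (X (ρ j)) with hw
  have hpareto : ∀ π : Equiv.Perm N, (∀ k, w k k ≤ w k (π k)) → ∀ k, w k (π k) ≤ w k k := by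
    intro π hπ k
    by_contra hlt
    push Not at hlt
    have h1 := hmax (ρ * π) (fun j => (hρ j).trans (hπ j))
    have h2 : ∑ j, w j j < ∑ j, w j (π j) :=
      Finset.sum_lt_sum (fun j _ => hπ j) ⟨k, Finset.mem_univ _, hlt⟩
    exact absurd h1 (not_le.2 h2)
  -- `i` is the only agent for whom `g` may be critical
  obtain ⟨i, hi⟩ : ∃ i, ∀ k, k ≠ i → 2 * v k g ≤ bundleValue v k (X k) := by
    by_cases h : ∃ i, IsCritical v X g i
    · obtain ⟨i, hi⟩ := h
      exact ⟨i, fun k hk => not_lt.1 fun hlt => hk (hcrit k i hlt hi)⟩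
    · push Not at h
      exact ⟨hN.some, fun k _ => not_lt.1 (h k)⟩
  obtain ⟨t, hti, ht⟩ := exists_source_reflTransGen hpareto i
  have ht' : ∀ k, w k t ≤ w k k := fun k => not_lt.1 (ht k)
  -- all conditions that do not involve the bundle with the new good
  have hold : ∀ k b, ∀ x ∈ X b, 2 * bundleValue v k (X b \ {x}) ≤ 3 * bundleValue v k (X k) := by
    intro k b x hx
    by_cases hkb : k = b
    · subst hkb
      have := bundleValue_mono hv k (Finset.sdiff_subset (s := X k) (t := {x}))
      have := bundleValue_nonneg hv k (X k)
      linarith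
    · exact hEFX k b hkb x hx
  have hnew : ∀ k x, k ≠ i → 2 * bundleValue v k (insert g (X (ρ t)) \ {x}) ≤ 3 * w k k := by
    intro k x hk
    have h1 := bundleValue_mono hv k (Finset.sdiff_subset (s := insert g (X (ρ t))) (t := {x}))
    have h2 := bundleValue_insert_le hv k g (X (ρ t))
    have h3 := ht' k
    have h4 := hi k hk
    have h5 := hρ k
    simp only [hw] at h3 ⊢
    linarith
  -- a general criterion for the allocations that occur in the two cases
  have main : ∀ (π : Equiv.Perm N) (s : N), π s = ρ t →
      (∀ k, k ≠ s → w k k ≤ bundleValue v k (X (π k))) →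
      w s s ≤ bundleValue v s (insert g (X (ρ t))) →
      (s ≠ i → ∀ x ∈ insert g (X (ρ t)),
        2 * bundleValue v i (insert g (X (ρ t)) \ {x}) ≤ 3 * bundleValue v i (X (π i))) →
      ∃ (π : Equiv.Perm N) (s : N), IsTwoThirdsEFX v (permuteAdd X π s g) ∧
      ∀ k, bundleValue v k (X k) ≤ bundleValue v k (permuteAdd X π s g k) := by
    intro π s hs hπ hss hsi
    have hge : ∀ k, w k k ≤ bundleValue v k (permuteAdd X π s g k) := by
      intro k
      by_cases hk : k = s
      · subst hk; simpa [permuteAdd, hs] using hss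
      · simpa [permuteAdd, hk] using hπ k hk
    refine ⟨π, s, ?_, fun k => (hρ k).trans (hge k)⟩
    intro k j hkj x hx
    by_cases hjs : j = s
    · subst hjs
      have e : permuteAdd X π j g j = insert g (X (ρ t)) := by simp [permuteAdd, hs]
      rw [e] at hx ⊢
      by_cases hk : k = i
      · subst hk
        have := hsi (Ne.symm hkj) x hx
        have h2 := bundleValue_mono hv k (subset_permuteAdd X π j g k)
        linarith
      · have := hnew k x hk
        have := hge k
        linarith
    · have e : permuteAdd X π s g j = X (π j) := by simp [permuteAdd, hjs]
      rw [e] at hx ⊢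
      have h1 := hold k (π j) x hx
      have h2 := hρ k
      have h3 := hge k
      simp only [hw] at h3
      linarith
  by_cases hobj : ∀ x ∈ insert g (X (ρ t)),
      2 * bundleValue v i (insert g (X (ρ t)) \ {x}) ≤ 3 * w i i
  · refine main ρ t rfl (fun k _ => le_rfl) ?_ (fun _ => hobj)
    exact bundleValue_mono hv t (Finset.subset_insert _ _)
  · push Not at hobj
    obtain ⟨x, -, hx⟩ := hobj
    obtain ⟨π, h1, h2⟩ := exists_perm_of_reflTransGen_envies hti
    refine main (ρ * π) i (by simp [h1]) (fun k hk => h2 k hk) ?_ (fun h => absurd rfl h)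
    have h3 := bundleValue_mono hv i (Finset.sdiff_subset (s := insert g (X (ρ t))) (t := {x}))
    have h4 : 0 ≤ w i i := bundleValue_nonneg hv i _
    linarith

end Extend

/-! ### Optimal allocations of single goods and pairs -/

section Pairs

variable {N M : Type*}

/-- The level of a bundle of at most two goods: its value, increased by one half if it is a pair. An
agent accepts pairs whose goods are worth at most her level, which implies `2/3`-EFX. She gives up
a single good for a pair that keeps two thirds of the value, and she gives up a pair for a single
good of one and a half times the value. -/
noncomputable def level (v : N → M → ℝ) (k : N) (S : Finset M) : ℝ :=
  if S.card ≤ 1 then bundleValue v k S else 3 / 2 * bundleValue v k S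

theorem level_of_card_le_one {v : N → M → ℝ} {k : N} {S : Finset M} (h : S.card ≤ 1) :
    level v k S = bundleValue v k S := if_pos h

theorem level_of_card_eq_two {v : N → M → ℝ} {k : N} {S : Finset M} (h : S.card = 2) :
    level v k S = 3 / 2 * bundleValue v k S := if_neg (by omega)

theorem bundleValue_le_level {v : N → M → ℝ} (hv : ∀ i g, 0 ≤ v i g) (k : N) (S : Finset M) :
    bundleValue v k S ≤ level v k S := by
  have := bundleValue_nonneg hv k S
  unfold level
  split_ifs <;> linarith

theorem level_le_bundleValue {v : N → M → ℝ} (hv : ∀ i g, 0 ≤ v i g) (k : N) (S : Finset M) :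
    level v k S ≤ 3 / 2 * bundleValue v k S := by
  have := bundleValue_nonneg hv k S
  unfold level
  split_ifs <;> linarith

/-- Partial allocations of bundles of at most two goods, in which every good of a pair is worth at
most the level of any agent. -/
structure IsPairAllocation (v : N → M → ℝ) (X : N → Finset M) : Prop where
  disjoint : IsPartialAllocation X
  card_le : ∀ k, (X k).card ≤ 2
  le_level : ∀ k j, (X j).card = 2 → ∀ x ∈ X j, v k x ≤ level v k (X k)

/-- The pair allocations of maximum total level. -/
structure IsOptimal [Fintype N] (v : N → M → ℝ) (X : N → Finset M) : Prop
    extends IsPairAllocation v X where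
  max : ∀ Y, IsPairAllocation v Y → ∑ k, level v k (Y k) ≤ ∑ k, level v k (X k)

theorem exists_isOptimal [Fintype N] [Fintype M] (v : N → M → ℝ) : ∃ X, IsOptimal v X := by
  classical
  obtain ⟨X, hX, hmax⟩ := Finset.exists_max_image
    (Finset.univ.filter fun X : N → Finset M => IsPairAllocation v X)
    (fun X => ∑ k, level v k (X k))
    ⟨fun _ => ∅, by simpa using ⟨fun _ _ _ => by simp, by simp, by simp⟩⟩
  simp only [Finset.mem_filter, Finset.mem_univ, true_and] at hX hmax
  exact ⟨X, hX, hmax⟩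

variable {v : N → M → ℝ} {X : N → Finset M}

theorem IsPairAllocation.isTwoThirdsEFX_aux [DecidableEq M] (hv : ∀ i g, 0 ≤ v i g)
    (hX : IsPairAllocation v X) (k j : N) {x : M} (hx : x ∈ X j) :
    2 * bundleValue v k (X j \ {x}) ≤ 2 * level v k (X k) := by
  have h0 := bundleValue_nonneg hv k (X k)
  have h1 := bundleValue_le_level hv k (X k)
  have hcard : (X j \ {x}).card = (X j).card - 1 := by
    rw [Finset.card_sdiff_of_subset (by simpa using hx)]; simp
  have h2 := hX.card_le j
  rcases Nat.lt_or_ge (X j).card 2 with h | h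
  · have : X j \ {x} = ∅ := Finset.card_eq_zero.1 (by omega)
    rw [this]
    simp only [bundleValue, Finset.sum_empty] at h0 h1 ⊢
    linarith
  · obtain ⟨y, hy⟩ := Finset.card_eq_one.1 (show (X j \ {x}).card = 1 by omega)
    have hyX : y ∈ X j := (Finset.mem_sdiff.1 (hy ▸ Finset.mem_singleton_self y)).1
    have := hX.le_level k j (by omega) y hyX
    rw [hy, bundleValue, Finset.sum_singleton]
    linarith

theorem IsPairAllocation.reassign (hX : IsPairAllocation v X) {π : Equiv.Perm N}
    (hπ : ∀ k, level v k (X k) ≤ level v k (X (π k))) : IsPairAllocation v (X ∘ π) where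
  disjoint _ _ hij := hX.disjoint _ _ (π.injective.ne hij)
  card_le _ := hX.card_le _
  le_level k _ hj x hx := (hX.le_level k _ hj x hx).trans (hπ k)

theorem IsPairAllocation.card_biUnion_le [Fintype N] [DecidableEq M] (hX : IsPairAllocation v X)
    (hN : Fintype.card N ≤ 8) : (Finset.univ.biUnion X).card ≤ 16 := by
  refine Finset.card_biUnion_le.trans ((Finset.sum_le_card_nsmul _ _ 2 fun k _ =>
    hX.card_le k).trans ?_)
  simp only [Finset.card_univ, smul_eq_mul]
  omega

/-- An agent whom nobody envies in terms of levels. -/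
def IsSource (v : N → M → ℝ) (X : N → Finset M) (s : N) : Prop :=
  ∀ k, ¬ Envies (fun k j => level v k (X j)) k s

theorem IsSource.le_single {s k : N} (hs : IsSource v X s)
    (hsc : (X s).card = 2) (hk : (X k).card = 1) :
    3 * bundleValue v k (X s) ≤ 2 * bundleValue v k (X k) := by
  have := not_lt.1 (hs k)
  simp only [level_of_card_eq_two hsc, level_of_card_le_one hk.le] at this
  linarith

theorem IsSource.le_pair {s k : N} (hs : IsSource v X s)
    (hsc : (X s).card = 2) (hk : (X k).card = 2) :
    bundleValue v k (X s) ≤ bundleValue v k (X k) := by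
  have := not_lt.1 (hs k)
  simp only [level_of_card_eq_two hsc, level_of_card_eq_two hk] at this
  linarith

namespace IsOptimal

variable [Fintype N]

theorem level_le (hX : IsOptimal v X) {Y : N → Finset M} (hY : IsPairAllocation v Y)
    (h : ∀ k, level v k (X k) ≤ level v k (Y k)) (k : N) :
    level v k (Y k) ≤ level v k (X k) := by
  by_contra hlt
  push Not at hlt
  exact absurd (hX.max Y hY)
    (not_le.2 (Finset.sum_lt_sum (fun j _ => h j) ⟨k, Finset.mem_univ _, hlt⟩))

theorem exists_source (hX : IsOptimal v X) (i : N) :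
    ∃ t, Relation.ReflTransGen (Envies fun k j => level v k (X j)) t i ∧ IsSource v X t :=
  exists_source_reflTransGen (fun _ hπ k => hX.level_le (hX.reassign hπ) hπ k) i

variable [DecidableEq N]

/-- If `i` can be reached from `t` in the envy graph of levels, then `i` could get any two of the
goods that `t` has or that are unallocated, while the bundles are shifted along the path. Hence
these goods do not raise the level of `i`. -/
theorem level_le_of_reach (hX : IsOptimal v X) {t i : N}
    (h : Relation.ReflTransGen (Envies fun k j => level v k (X j)) t i) {T : Finset M}
    (hT : ∀ x ∈ T, x ∈ X t ∨ ∀ j, x ∉ X j) (hcard : T.card ≤ 2)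
    (hlevel : T.card = 2 → ∀ x ∈ T, ∀ k, v k x ≤ level v k (X k)) :
    level v i T ≤ level v i (X i) := by
  by_contra hlt
  push Not at hlt
  obtain ⟨π, hπi, hπ⟩ := exists_perm_of_reflTransGen_envies h
  have hge : ∀ k, level v k (X k) ≤ level v k (Function.update (X ∘ π) i T k) := by
    intro k
    by_cases hk : k = i
    · subst hk; simpa using hlt.le
    · simpa [hk] using hπ k hk
  have hdisj : ∀ k, k ≠ i → Disjoint T (X (π k)) := by
    intro k hk
    have hne : π k ≠ t := fun e => hk (π.injective (e.trans hπi.symm))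
    refine Finset.disjoint_left.2 fun x hx hx' => ?_
    rcases hT x hx with h' | h'
    · exact Finset.disjoint_left.1 (hX.disjoint _ _ hne) hx' h'
    · exact h' _ hx'
  have hY : IsPairAllocation v (Function.update (X ∘ π) i T) := by
    refine ⟨fun k j hkj => ?_, fun k => ?_, fun k j hj x hx => ?_⟩
    · by_cases hk : k = i
      · subst hk
        simpa [hkj.symm] using hdisj j hkj.symm
      · by_cases hj : j = i
        · subst hj
          simpa [hkj] using (hdisj k hk).symm
        · simpa [hk, hj] using hX.disjoint _ _ (π.injective.ne hkj)
    · by_cases hk : k = i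
      · subst hk; simpa using hcard
      · simpa [hk] using hX.card_le _
    · refine le_trans ?_ (hge k)
      by_cases hji : j = i
      · subst hji
        rw [Function.update_self] at hj hx
        exact hlevel hj x hx k
      · simp only [Function.update_of_ne hji, Function.comp_apply] at hj hx
        exact hX.le_level k _ hj x hx
  have := hX.level_le hY hge i
  rw [Function.update_self] at this
  exact absurd this (not_le.2 hlt)

theorem le_level_of_pool (hX : IsOptimal v X) {g : M} (hg : ∀ j, g ∉ X j) (k : N) :
    v k g ≤ level v k (X k) := by
  have := hX.level_le_of_reach (T := {g}) (Relation.ReflTransGen.refl (a := k))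
    (by simpa using Or.inr hg) (by simp) (by simp)
  rwa [level_of_card_le_one (by simp), bundleValue, Finset.sum_singleton] at this

theorem pair_le (hX : IsOptimal v X) {t i : N}
    (h : Relation.ReflTransGen (Envies fun k j => level v k (X j)) t i) {T : Finset M}
    (hT : ∀ x ∈ T, (x ∈ X t ∧ (X t).card = 2) ∨ ∀ j, x ∉ X j) (hcard : T.card = 2) :
    3 / 2 * bundleValue v i T ≤ level v i (X i) := by
  rw [← level_of_card_eq_two hcard]
  refine hX.level_le_of_reach h (fun x hx => (hT x hx).imp_left And.left) hcard.le
    fun _ x hx k => ?_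
  rcases hT x hx with h' | h'
  · exact hX.le_level k t h'.2 x h'.1
  · exact hX.le_level_of_pool h' k

theorem card_pos (hX : IsOptimal v X) (hv : ∀ i g, 0 < v i g) {g : M} (hg : ∀ j, g ∉ X j) (k : N) :
    0 < (X k).card := by
  have h1 := hX.le_level_of_pool hg k
  by_contra h
  have : X k = ∅ := Finset.card_eq_zero.1 (by omega)
  rw [this, level_of_card_le_one (by simp), bundleValue, Finset.sum_empty] at h1
  exact absurd h1 (not_le.2 (hv k g))

/-- As long as there is an unallocated good, sources have pairs: a source with a single good could
add the unallocated good. -/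
theorem card_source [DecidableEq M] (hX : IsOptimal v X) (hv : ∀ i g, 0 < v i g)
    {g : M} (hg : ∀ j, g ∉ X j) {s : N}
    (hs : IsSource v X s) : (X s).card = 2 := by
  by_contra hne
  have hc : (X s).card = 1 := by
    have := hX.card_le s
    have := hX.card_pos hv hg s
    omega
  obtain ⟨c, hc⟩ := Finset.card_eq_one.1 hc
  have hgc : g ∉ ({c} : Finset M) := hc ▸ hg s
  have hlv : level v s (X s) < level v s (insert g (X s)) := by
    rw [hc, level_of_card_le_one (by simp), level_of_card_eq_two (Finset.card_insert_of_notMem hgc)]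
    simp only [bundleValue, Finset.sum_insert hgc, Finset.sum_singleton]
    linarith [hv s g, hv s c]
  have hge : ∀ k, level v k (X k) ≤ level v k (Function.update X s (insert g (X s)) k) := by
    intro k
    by_cases hk : k = s
    · subst hk; simpa using hlv.le
    · simp [hk]
  have hY : IsPairAllocation v (Function.update X s (insert g (X s))) := by
    refine ⟨fun k j hkj => ?_, fun k => ?_, fun k j hj x hx => ?_⟩
    · by_cases hk : k = s
      · subst hk
        simpa [hkj.symm] using ⟨hg j, hX.disjoint _ _ hkj⟩
      · by_cases hj : j = s
        · subst hj
          simpa [hkj] using ⟨hg k, hX.disjoint _ _ hkj⟩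
        · simpa [hk, hj] using hX.disjoint _ _ hkj
    · by_cases hk : k = s
      · subst hk
        rw [Function.update_self, hc, Finset.card_insert_of_notMem hgc]
        simp
      · simpa [hk] using hX.card_le _
    · refine le_trans ?_ (hge k)
      by_cases hjs : j = s
      · subst hjs
        rw [Function.update_self, hc] at hx
        rcases Finset.mem_insert.1 hx with rfl | hx
        · exact hX.le_level_of_pool hg k
        · have := not_lt.1 (hs k)
          rw [Finset.mem_singleton.1 hx]
          beta_reduce at this
          rwa [hc, level_of_card_le_one (by simp), bundleValue, Finset.sum_singleton] at this
      · rw [Function.update_of_ne hjs] at hj hx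
        exact hX.le_level k j hj x hx
  have := hX.level_le hY hge s
  rw [Function.update_self] at this
  exact absurd this (not_le.2 hlv)

theorem card_eq_one_or_two (hX : IsOptimal v X) (hv : ∀ i g, 0 < v i g)
    {g : M} (hg : ∀ j, g ∉ X j) (k : N) :
    (X k).card = 1 ∨ (X k).card = 2 := by
  have := hX.card_le k
  have := hX.card_pos hv hg k
  omega

theorem not_isCritical_of_card [DecidableEq M] (hX : IsOptimal v X) {g : M} (hg : ∀ j, g ∉ X j)
    {k : N} (hk : (X k).card = 2) : 2 * v k g ≤ bundleValue v k (X k) := by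
  obtain ⟨a, b, hab, he⟩ := Finset.card_eq_two.1 hk
  have key : ∀ x ∈ X k, v k x + v k g ≤ bundleValue v k (X k) := by
    intro x hx
    have hxg : x ≠ g := fun e => hg k (e ▸ hx)
    have := hX.pair_le (T := {x, g}) (Relation.ReflTransGen.refl (a := k))
      (by simpa using ⟨Or.inl ⟨hx, hk⟩, Or.inr hg⟩) (Finset.card_pair hxg)
    rw [level_of_card_eq_two hk, bundleValue, Finset.sum_pair hxg] at this
    linarith
  have ha := key a (by simp [he])
  have hb := key b (by simp [he])
  rw [he, bundleValue, Finset.sum_pair hab] at *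
  linarith

theorem card_of_isCritical [DecidableEq M] (hX : IsOptimal v X) (hv : ∀ i g, 0 < v i g)
    {g : M} (hg : ∀ j, g ∉ X j)
    {k : N} (hk : IsCritical v X g k) : (X k).card = 1 :=
  (hX.card_eq_one_or_two hv hg k).resolve_right fun h =>
    absurd hk (not_lt.2 (hX.not_isCritical_of_card hg h))

/-- An agent with a single good values at most two unallocated goods together at no more than two
thirds of it. -/
theorem pool_le [DecidableEq M] (hX : IsOptimal v X) (hv : ∀ i g, 0 < v i g)
    {k : N} (hk : (X k).card = 1) {A : Finset M}
    (hA : ∀ x ∈ A, ∀ j, x ∉ X j) (hcard : A.card ≤ 2) :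
    3 * bundleValue v k A ≤ 2 * bundleValue v k (X k) := by
  have h0 := bundleValue_nonneg (fun i g => (hv i g).le) k (X k)
  have hk' := level_of_card_le_one (v := v) (k := k) hk.le
  interval_cases h : A.card
  · rw [Finset.card_eq_zero.1 h]
    simp only [bundleValue, Finset.sum_empty] at h0 ⊢
    linarith
  · obtain ⟨g, rfl⟩ := Finset.card_eq_one.1 h
    have hg : ∀ j, g ∉ X j := hA g (by simp)
    obtain ⟨t, ht, hts⟩ := hX.exists_source k
    have htc := hX.card_source hv hg hts
    obtain ⟨x, hx⟩ := Finset.card_pos.1 (show 0 < (X t).card by omega)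
    have hxg : x ≠ g := fun e => hg t (e ▸ hx)
    have := hX.pair_le (T := {x, g}) ht (by simpa using ⟨Or.inl ⟨hx, htc⟩, Or.inr hg⟩)
      (Finset.card_pair hxg)
    rw [hk', bundleValue, Finset.sum_pair hxg] at this
    rw [bundleValue, Finset.sum_singleton]
    linarith [hv k x]
  · have := hX.pair_le (Relation.ReflTransGen.refl (a := k)) (fun x hx => Or.inr (hA x hx)) h
    rw [hk'] at this
    linarith

theorem isCritical_unique [DecidableEq M] (hX : IsOptimal v X) (hv : ∀ i g, 0 < v i g)
    {g g' : M} (hg : ∀ j, g ∉ X j)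
    (hg' : ∀ j, g' ∉ X j) {k : N} (hk : IsCritical v X g k) (hk' : IsCritical v X g' k) :
    g = g' := by
  by_contra hne
  have := hX.pool_le hv (hX.card_of_isCritical hv hg hk) (A := {g, g'}) (by simpa using ⟨hg, hg'⟩)
    Finset.card_le_two
  rw [bundleValue, Finset.sum_pair hne] at this
  have h0 := bundleValue_nonneg (fun i g => (hv i g).le) k (X k)
  unfold IsCritical at hk hk'
  linarith

open Classical in
/-- Different unallocated goods are critical for different agents, so the numbers of these agents
add up. -/
theorem card_critical [DecidableEq M] (hX : IsOptimal v X) (hv : ∀ i g, 0 < v i g)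
    (C : Finset M) (hC : ∀ g ∈ C, ∀ j, g ∉ X j) :
    ∑ g ∈ C, (Finset.univ.filter fun k => IsCritical v X g k).card =
      (Finset.univ.filter fun k => ∃ g ∈ C, IsCritical v X g k).card := by
  rw [← Finset.card_biUnion]
  · congr 1
    ext k
    simp
  · intro g hg g' hg' hne
    refine Finset.disjoint_left.2 fun k hk hk' => hne ?_
    exact hX.isCritical_unique hv (hC g hg) (hC g' hg') (Finset.mem_filter.1 hk).2
      (Finset.mem_filter.1 hk').2

theorem critical_le [DecidableEq M] (hX : IsOptimal v X) (hv : ∀ i g, 0 < v i g)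
    (hN : Fintype.card N ≤ 8) (C : Finset M)
    (hC : ∀ g ∈ C, (∀ j, g ∉ X j) ∧ ∃ k, IsCritical v X g k) : C.card ≤ 8 := by
  classical
  have h1 := hX.card_critical hv C fun g hg => (hC g hg).1
  have h2 : C.card ≤ ∑ g ∈ C, (Finset.univ.filter fun k => IsCritical v X g k).card := by
    rw [Finset.card_eq_sum_ones]
    refine Finset.sum_le_sum fun g hg => Finset.card_pos.2 ?_
    obtain ⟨k, hk⟩ := (hC g hg).2
    exact ⟨k, by simpa using hk⟩
  have h3 := Finset.card_le_univ (Finset.univ.filter fun k => ∃ g ∈ C, IsCritical v X g k)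
  omega

/-- A source can be given one or, if only agents with a single good are concerned, two unallocated
goods. -/
theorem source_union_le [DecidableEq M] (hX : IsOptimal v X) (hv : ∀ i g, 0 < v i g)
    {s k : N} (hs : IsSource v X s) (hsc : (X s).card = 2) {A : Finset M}
    (hA : ∀ x ∈ A, ∀ j, x ∉ X j) (hA2 : A.card ≤ 2) (hk : A.card ≤ 1 ∨ (X k).card = 1)
    (hk' : 0 < (X k).card) :
    2 * bundleValue v k (X s ∪ A) ≤ 3 * bundleValue v k (X k) := by
  have hv0 : ∀ i g, 0 ≤ v i g := fun i g => (hv i g).le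
  have h1 := bundleValue_union_le hv0 k (X s) A
  have h2 := bundleValue_nonneg hv0 k (X k)
  have h3 := hX.card_le k
  by_cases hc : (X k).card = 1
  · have h4 := hs.le_single hsc hc
    have h5 := hX.pool_le hv hc hA hA2
    linarith
  · have h4 := hs.le_pair hsc (show (X k).card = 2 by omega)
    have h5 : 2 * bundleValue v k A ≤ bundleValue v k (X k) := by
      by_cases he : A = ∅
      · simpa [he, bundleValue] using h2
      · obtain ⟨g, hg⟩ := Finset.card_eq_one.1
          (le_antisymm (hk.resolve_right hc)
            (Finset.card_pos.2 (Finset.nonempty_iff_ne_empty.2 he)))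
        rw [hg, bundleValue, Finset.sum_singleton]
        exact hX.not_isCritical_of_card (hA g (by simp [hg])) (by omega)
    linarith

end IsOptimal

end Pairs

/-! ### Allocating all critical goods -/

section Seed

variable {N M : Type*} [Fintype N] [DecidableEq N] [Fintype M] [DecidableEq M]

/-- A partial `2/3`-EFX allocation `Z` of at most 19 goods, in which every unallocated good is
critical for at most one agent, and at most 8 of them are critical. -/
structure IsNearSeed (v : N → M → ℝ) (Z : N → Finset M) : Prop where
  disjoint : IsPartialAllocation Z
  efx : IsTwoThirdsEFX v Z
  unique : ∀ g, (∀ j, g ∉ Z j) → ∀ k k', IsCritical v Z g k → IsCritical v Z g k' → k = k'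
  card_le : (Finset.univ.biUnion Z).card ≤ 19
  critical_le : ∀ C : Finset M, (∀ g ∈ C, (∀ j, g ∉ Z j) ∧ ∃ k, IsCritical v Z g k) → C.card ≤ 8

/-- A partial `2/3`-EFX allocation of at most 27 goods without critical unallocated goods. -/
structure IsSeed (v : N → M → ℝ) (Z : N → Finset M) : Prop where
  disjoint : IsPartialAllocation Z
  efx : IsTwoThirdsEFX v Z
  not_critical : ∀ g, (∀ j, g ∉ Z j) → ∀ k, 2 * v k g ≤ bundleValue v k (Z k)
  card_le : (Finset.univ.biUnion Z).card ≤ 27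

/-- The critical goods are added one by one; no good becomes critical in the process. -/
theorem IsNearSeed.exists_isSeed {v : N → M → ℝ} (hv : ∀ i g, 0 ≤ v i g) {Z : N → Finset M}
    (hZ : IsNearSeed v Z) : ∃ Y, IsSeed v Y := by
  classical
  suffices key : ∀ (c : ℕ) (Z : N → Finset M), IsPartialAllocation Z → IsTwoThirdsEFX v Z →
      (∀ g, (∀ j, g ∉ Z j) → ∀ k k', IsCritical v Z g k → IsCritical v Z g k' → k = k') →
      (Finset.univ.biUnion Z).card + c ≤ 27 →
      (Finset.univ.filter fun g => (∀ j, g ∉ Z j) ∧ ∃ k, IsCritical v Z g k).card ≤ c →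
      ∃ Y, IsSeed v Y from
    key 8 Z hZ.disjoint hZ.efx hZ.unique (by have := hZ.card_le; omega)
      (hZ.critical_le _ (by simp))
  intro c
  induction c with
  | zero =>
    intro Z h1 h2 _ h4 h5
    refine ⟨Z, h1, h2, fun g hg k => not_lt.1 fun hk => ?_, h4⟩
    have h0 := Finset.card_eq_zero.1 (Nat.le_zero.1 h5)
    exact Finset.notMem_empty g (h0 ▸ Finset.mem_filter.2 ⟨Finset.mem_univ _, hg, k, hk⟩)
  | succ c ih =>
    intro Z h1 h2 h3 h4 h5
    by_cases hex : ∃ g, (∀ j, g ∉ Z j) ∧ ∃ k, IsCritical v Z g k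
    · obtain ⟨g, hg, k, hk⟩ := hex
      obtain ⟨π, s, hE, hge⟩ := exists_permuteAdd hv h2 ⟨k⟩ (h3 g hg)
      have hpool : ∀ x, (∀ j, x ∉ permuteAdd Z π s g j) → (∀ j, x ∉ Z j) ∧ x ≠ g := by
        refine fun x hx => ⟨fun j hj => ?_, fun e => ?_⟩
        · refine hx (π.symm j) (subset_permuteAdd Z π s g _ ?_)
          simpa using hj
        · exact hx s (mem_permuteAdd.2 (Or.inr ⟨rfl, e⟩))
      have hcrit : ∀ x k, IsCritical v (permuteAdd Z π s g) x k → IsCritical v Z x k :=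
        fun x k hx => lt_of_le_of_lt (hge k) hx
      refine ih _ (isPartialAllocation_permuteAdd h1 hg π s) hE ?_ ?_ ?_
      · exact fun x hx k k' hk hk' => h3 x (hpool x hx).1 k k' (hcrit x k hk) (hcrit x k' hk')
      · have hsub : Finset.univ.biUnion (permuteAdd Z π s g) ⊆
            insert g (Finset.univ.biUnion Z) := by
          intro x hx
          obtain ⟨j, -, hj⟩ := Finset.mem_biUnion.1 hx
          rcases mem_permuteAdd.1 hj with h | ⟨-, rfl⟩
          · exact Finset.mem_insert_of_mem (Finset.mem_biUnion.2 ⟨_, Finset.mem_univ _, h⟩)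
          · exact Finset.mem_insert_self _ _
        have := (Finset.card_le_card hsub).trans (Finset.card_insert_le _ _)
        omega
      · have hsub : (Finset.univ.filter fun x => (∀ j, x ∉ permuteAdd Z π s g j) ∧
            ∃ k, IsCritical v (permuteAdd Z π s g) x k) ⊆
            (Finset.univ.filter fun x => (∀ j, x ∉ Z j) ∧ ∃ k, IsCritical v Z x k).erase g := by
          intro x hx
          obtain ⟨-, hx, k, hk⟩ := Finset.mem_filter.1 hx
          exact Finset.mem_erase.2 ⟨(hpool x hx).2,
            Finset.mem_filter.2 ⟨Finset.mem_univ _, (hpool x hx).1, k, hcrit x k hk⟩⟩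
        have h6 := Finset.card_le_card hsub
        rw [Finset.card_erase_of_mem (Finset.mem_filter.2 ⟨Finset.mem_univ _, hg, k, hk⟩)] at h6
        omega
    · refine ih Z h1 h2 h3 (by omega) ?_
      have : (Finset.univ.filter fun g => (∀ j, g ∉ Z j) ∧ ∃ k, IsCritical v Z g k) = ∅ :=
        Finset.filter_eq_empty_iff.2 fun g _ hg => hex ⟨g, hg⟩
      simp [this]

variable {v : N → M → ℝ} {X : N → Finset M}

open Classical in
/-- The contested goods: the unallocated goods that are critical for at least two agents. -/
noncomputable def contested (v : N → M → ℝ) (X : N → Finset M) : Finset M :=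
  Finset.univ.filter fun g =>
    (∀ j, g ∉ X j) ∧ ∃ k k', k ≠ k' ∧ IsCritical v X g k ∧ IsCritical v X g k'

theorem mem_contested {g : M} : g ∈ contested v X ↔
    (∀ j, g ∉ X j) ∧ ∃ k k', k ≠ k' ∧ IsCritical v X g k ∧ IsCritical v X g k' := by
  simp [contested]

/-- The allocation in which every contested good `g` is added to the bundle of agent `f g`. -/
noncomputable def attach (v : N → M → ℝ) (X : N → Finset M) (f : M → N) :
    N → Finset M :=
  fun k => X k ∪ (contested v X).filter fun g => f g = k

namespace IsOptimal

open Classical in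
/-- There are two agents for each contested good, and none of them has a pair. -/
theorem card_contested (hX : IsOptimal v X) (hv : ∀ i g, 0 < v i g) :
    2 * (contested v X).card + (Finset.univ.filter fun k => (X k).card = 2).card ≤
      (Finset.univ.filter fun k => (X k).card = 2 ∨ ∃ g ∈ contested v X,
        IsCritical v X g k).card := by
  have h1 := hX.card_critical hv (contested v X) fun g hg => (mem_contested.1 hg).1
  have h2 : 2 * (contested v X).card ≤
      ∑ g ∈ contested v X, (Finset.univ.filter fun k => IsCritical v X g k).card := by
    rw [mul_comm, ← smul_eq_mul]
    refine Finset.card_nsmul_le_sum _ _ _ fun g hg => ?_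
    obtain ⟨-, k, k', hne, hk, hk'⟩ := mem_contested.1 hg
    exact Finset.one_lt_card.2 ⟨k, by simpa using hk, k', by simpa using hk', hne⟩
  have h3 : Disjoint (Finset.univ.filter fun k => (X k).card = 2)
      (Finset.univ.filter fun k => ∃ g ∈ contested v X, IsCritical v X g k) := by
    refine Finset.disjoint_left.2 fun k hk hk' => ?_
    obtain ⟨-, g, hg, hgk⟩ := Finset.mem_filter.1 hk'
    have := hX.card_of_isCritical hv (mem_contested.1 hg).1 hgk
    have := (Finset.mem_filter.1 hk).2
    omega
  rw [Finset.filter_or, Finset.card_union_of_disjoint h3]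
  omega

/-- It suffices to give the contested goods to sources in such a way that the condition EFX holds
towards these sources. -/
theorem isNearSeed_attach (hX : IsOptimal v X) (hv : ∀ i g, 0 < v i g) (hN : Fintype.card N ≤ 8)
    (hR : (contested v X).card ≤ 3) (f : M → N)
    (hf : ∀ k j, k ≠ j → (∃ g ∈ contested v X, f g = j) → ∀ x ∈ attach v X f j,
      2 * bundleValue v k (attach v X f j \ {x}) ≤ 3 * bundleValue v k (attach v X f k)) :
    IsNearSeed v (attach v X f) := by
  have hv0 : ∀ i g, 0 ≤ v i g := fun i g => (hv i g).le
  have hge : ∀ k, bundleValue v k (X k) ≤ bundleValue v k (attach v X f k) := fun k =>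
    bundleValue_mono hv0 k Finset.subset_union_left
  have hpool : ∀ g, (∀ j, g ∉ attach v X f j) → (∀ j, g ∉ X j) ∧ g ∉ contested v X := by
    refine fun g hg => ⟨fun j hj => hg j (Finset.mem_union_left _ hj), fun h => ?_⟩
    exact hg (f g) (Finset.mem_union_right _ (Finset.mem_filter.2 ⟨h, rfl⟩))
  have hcrit : ∀ g k, IsCritical v (attach v X f) g k → IsCritical v X g k :=
    fun g k h => lt_of_le_of_lt (hge k) h
  refine ⟨fun i j hij => ?_, fun k j hkj x hx => ?_, fun g hg k k' hk hk' => ?_, ?_, fun C hC => ?_⟩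
  · refine Finset.disjoint_left.2 fun x hx hx' => ?_
    rcases Finset.mem_union.1 hx with h | h <;> rcases Finset.mem_union.1 hx' with h' | h'
    · exact Finset.disjoint_left.1 (hX.disjoint i j hij) h h'
    · exact (mem_contested.1 (Finset.mem_filter.1 h').1).1 i h
    · exact (mem_contested.1 (Finset.mem_filter.1 h).1).1 j h'
    · exact hij ((Finset.mem_filter.1 h).2.symm.trans (Finset.mem_filter.1 h').2)
  · by_cases hj : ∃ g ∈ contested v X, f g = j
    · exact hf k j hkj hj x hx
    · have e : attach v X f j = X j := by
        unfold attach
        rw [Finset.filter_eq_empty_iff.2 fun g hg e => hj ⟨g, hg, e⟩, Finset.union_empty]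
      rw [e] at hx ⊢
      have h1 := hX.isTwoThirdsEFX_aux hv0 k j hx
      have h2 := level_le_bundleValue hv0 k (X k)
      have h3 := hge k
      linarith
  · by_contra hne
    exact (hpool g hg).2 (mem_contested.2 ⟨(hpool g hg).1, k, k', hne, hcrit g k hk,
      hcrit g k' hk'⟩)
  · have hsub : Finset.univ.biUnion (attach v X f) ⊆
        Finset.univ.biUnion X ∪ contested v X := by
      refine Finset.biUnion_subset.2 fun k _ => Finset.union_subset_union ?_ ?_
      · exact Finset.subset_biUnion_of_mem X (Finset.mem_univ k)
      · exact Finset.filter_subset _ _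
    have h1 := (Finset.card_le_card hsub).trans (Finset.card_union_le _ _)
    have h2 := hX.card_biUnion_le hN
    omega
  · refine hX.critical_le hv hN C fun g hg => ?_
    obtain ⟨h1, k, hk⟩ := hC g hg
    exact ⟨(hpool g h1).1, k, hcrit g k hk⟩

end IsOptimal

end Seed

/-! ### Giving the contested goods to the sources -/

section PairSums

/-- If any two elements of `Z` have sum at most `ρ`, then so do at most two elements. -/
theorem sum_le_of_card_le_two {M : Type*} [DecidableEq M] {w : M → ℝ} (hw : ∀ x, 0 ≤ w x)
    {Z : Finset M} (hZ : 2 ≤ Z.card) {ρ : ℝ}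
    (h : ∀ T ⊆ Z, T.card = 2 → ∑ x ∈ T, w x ≤ ρ) {T : Finset M} (hT : T ⊆ Z) (hc : T.card ≤ 2) :
    ∑ x ∈ T, w x ≤ ρ := by
  obtain ⟨U, hTU, hUZ, hU⟩ := Finset.exists_subsuperset_card_eq hT hc hZ
  exact (Finset.sum_le_sum_of_subset_of_nonneg hTU fun x _ _ => hw x).trans (h U hUZ hU)

theorem sum_le_of_card_le_four {M : Type*} [DecidableEq M] {w : M → ℝ} (hw : ∀ x, 0 ≤ w x)
    {Z : Finset M} (hZ : 2 ≤ Z.card) {ρ : ℝ}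
    (h : ∀ T ⊆ Z, T.card = 2 → ∑ x ∈ T, w x ≤ ρ) {T : Finset M} (hT : T ⊆ Z) (hc : T.card ≤ 4) :
    ∑ x ∈ T, w x ≤ 2 * ρ := by
  obtain ⟨U, hUT, hU⟩ := Finset.exists_subset_card_eq (Nat.min_le_left T.card 2)
  have h1 := sum_le_of_card_le_two hw hZ h (hUT.trans hT) (by omega)
  have h2 := sum_le_of_card_le_two hw hZ h (T := T \ U) (Finset.sdiff_subset.trans hT)
    (by rw [Finset.card_sdiff_of_subset hUT]; omega)
  have h3 := Finset.sum_sdiff (f := w) hUT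
  linarith

theorem sum_le_of_card_le_three {M : Type*} [DecidableEq M] {w : M → ℝ} (hw : ∀ x, 0 ≤ w x)
    {Z : Finset M} (hZ : 2 ≤ Z.card) {ρ : ℝ}
    (h : ∀ T ⊆ Z, T.card = 2 → ∑ x ∈ T, w x ≤ ρ) {T : Finset M} (hT : T ⊆ Z) (hc : T.card ≤ 3) :
    ∑ x ∈ T, w x ≤ 3 / 2 * ρ := by
  rcases Nat.lt_or_ge T.card 3 with h' | h'
  · have h1 := sum_le_of_card_le_two hw hZ h hT (by omega)
    have h2 := Finset.sum_nonneg (s := T) fun x _ => hw x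
    linarith
  · obtain ⟨a, b, c, hab, hac, hbc, rfl⟩ := Finset.card_eq_three.1 (le_antisymm hc h')
    have h1 := h {a, b} (fun x hx => hT (by simp at hx ⊢; tauto)) (Finset.card_pair hab)
    have h2 := h {a, c} (fun x hx => hT (by simp at hx ⊢; tauto)) (Finset.card_pair hac)
    have h3 := h {b, c} (fun x hx => hT (by simp at hx ⊢; tauto)) (Finset.card_pair hbc)
    rw [Finset.sum_pair ‹_›] at h1 h2 h3
    rw [Finset.sum_insert (by simp [hab, hac]), Finset.sum_pair hbc]
    linarith

end PairSums

section Cases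

variable {N M : Type*} [Fintype N] [DecidableEq N] [Fintype M] [DecidableEq M]
variable {v : N → M → ℝ} {X : N → Finset M}

namespace IsOptimal

/-- Contested goods can be given to different sources. -/
theorem isNearSeed_attach_of_injOn (hX : IsOptimal v X) (hv : ∀ i g, 0 < v i g)
    (hN : Fintype.card N ≤ 8) (hR : (contested v X).card ≤ 3) (f : M → N)
    (hfS : ∀ g ∈ contested v X, IsSource v X (f g))
    (hf : ∀ g ∈ contested v X, ∀ g' ∈ contested v X, f g = f g' → g = g') :
    IsNearSeed v (attach v X f) := by
  have hv0 : ∀ i g, 0 ≤ v i g := fun i g => (hv i g).le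
  refine hX.isNearSeed_attach hv hN hR f ?_
  rintro k j hkj ⟨g, hg, rfl⟩ x hx
  have hgp := (mem_contested.1 hg).1
  have hA : ((contested v X).filter fun g' => f g' = f g).card ≤ 1 :=
    Finset.card_le_one.2 fun a ha b hb => by
      obtain ⟨ha, ha'⟩ := Finset.mem_filter.1 ha
      obtain ⟨hb, hb'⟩ := Finset.mem_filter.1 hb
      exact hf a ha b hb (ha'.trans hb'.symm)
  have h1 := hX.source_union_le hv (k := k) (hfS g hg) (hX.card_source hv hgp (hfS g hg))
    (fun y hy => (mem_contested.1 (Finset.mem_filter.1 hy).1).1) (by omega) (Or.inl hA)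
    (hX.card_pos hv hgp k)
  have h2 := bundleValue_mono hv0 k (Finset.sdiff_subset (s := attach v X f (f g)) (t := {x}))
  have h3 : bundleValue v k (X k) ≤ bundleValue v k (attach v X f k) :=
    bundleValue_mono hv0 k Finset.subset_union_left
  change 2 * bundleValue v k (attach v X f (f g)) ≤ _ at h1
  linarith

/-- Three contested goods are shared by two agents with pairs: the second agent takes the one she
likes best. -/
theorem exists_isNearSeed_of_two_sources (hX : IsOptimal v X) (hv : ∀ i g, 0 < v i g)
    (hN : Fintype.card N ≤ 8) (hR : (contested v X).card = 3) {s t : N} (hst : s ≠ t)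
    (hs : IsSource v X s) (ht : IsSource v X t)
    (hpair : ∀ k, (X k).card = 2 → k = s ∨ k = t) : ∃ f, IsNearSeed v (attach v X f) := by
  classical
  have hv0 : ∀ i g, 0 ≤ v i g := fun i g => (hv i g).le
  obtain ⟨c, hc, hmax⟩ := Finset.exists_max_image (contested v X) (v t)
    (Finset.card_pos.1 (by omega))
  have hcp := (mem_contested.1 hc).1
  have hp : ∀ g ∈ contested v X, ∀ j, g ∉ X j := fun g hg => (mem_contested.1 hg).1
  obtain ⟨f, hf⟩ : ∃ f : M → N, f = fun g => if g = c then t else s := ⟨_, rfl⟩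
  refine ⟨f, hX.isNearSeed_attach hv hN hR.le f ?_⟩
  have hfs : (contested v X).filter (fun g => f g = s) = (contested v X).erase c := by
    ext g
    by_cases h : g = c <;> simp [hf, h, hst.symm]
  have hft : (contested v X).filter (fun g => f g = t) = {c} := by
    ext g
    by_cases h : g = c <;> simp [hf, h, hst, hc]
  have hAs : attach v X f s = X s ∪ (contested v X).erase c := by rw [attach, hfs]
  have hAt : attach v X f t = X t ∪ {c} := by rw [attach, hft]
  have hcard : ((contested v X).erase c).card = 2 := by rw [Finset.card_erase_of_mem hc, hR]
  have hge : ∀ k, bundleValue v k (X k) ≤ bundleValue v k (attach v X f k) := fun k =>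
    bundleValue_mono hv0 k Finset.subset_union_left
  have hsc := hX.card_source hv hcp hs
  have htc := hX.card_source hv hcp ht
  rintro k j hkj ⟨g, -, rfl⟩ x -
  have h2 := bundleValue_mono hv0 k (Finset.sdiff_subset (s := attach v X f (f g)) (t := {x}))
  have h3 := hge k
  by_cases hg : g = c
  · have e : f g = t := by simp [hf, hg]
    rw [e] at h2 ⊢
    have h1 := hX.source_union_le hv (k := k) ht htc (A := {c}) (by simpa using hcp) (by simp)
      (by simp) (hX.card_pos hv hcp k)
    rw [← hAt] at h1
    linarith
  · have e : f g = s := by simp [hf, hg]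
    rw [e] at h2 hkj ⊢
    rcases hX.card_eq_one_or_two hv hcp k with hk | hk
    · have h1 := hX.source_union_le hv (k := k) hs hsc (A := (contested v X).erase c)
        (fun y hy => hp y (Finset.mem_of_mem_erase hy)) hcard.le (Or.inr hk) (by omega)
      rw [← hAs] at h1
      linarith
    · obtain rfl : k = t := (hpair k hk).resolve_left hkj
      have h4 := bundleValue_union_le hv0 k (X s) ((contested v X).erase c)
      rw [← hAs] at h4
      have h5 : bundleValue v k ((contested v X).erase c) ≤ 2 * v k c := by
        refine (Finset.sum_le_card_nsmul _ _ (v k c) fun y hy =>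
          hmax y (Finset.mem_of_mem_erase hy)).trans ?_
        rw [hcard]
        simp
      have h6 : bundleValue v k (attach v X f k) = bundleValue v k (X k) + v k c := by
        rw [hAt, bundleValue, Finset.sum_union (by simpa using hcp k), Finset.sum_singleton]
        rfl
      have h7 := hs.le_pair hsc hk
      have h8 := hX.not_isCritical_of_card hcp hk
      have h9 := hv k c
      linarith

/-- If an agent `k` with a pair values the pair of the only source together with three contested
goods at more than three halves of her own pair, then the bundles are shifted along a path from the
source to `k`, who receives these five goods except for the good of the source that she likes less.
This good may only be critical for the source. -/
theorem exists_isNearSeed_of_shift (hX : IsOptimal v X) (hv : ∀ i g, 0 < v i g)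
    (hN : Fintype.card N ≤ 8) (hR : (contested v X).card = 3) {s k : N} (hks : k ≠ s)
    (hs : IsSource v X s)
    (hreach : ∀ i, Relation.ReflTransGen (Envies fun k j => level v k (X j)) s i)
    (hsc : (X s).card = 2) (hkc : (X k).card = 2)
    (hcrit : ∀ i, i ≠ s → i ≠ k → ∃ g ∈ contested v X, IsCritical v X g i)
    (hobj : 3 * bundleValue v k (X k) < 2 * bundleValue v k (X s ∪ contested v X)) :
    ∃ Z, IsNearSeed v Z := by
  have hv0 : ∀ i g, 0 ≤ v i g := fun i g => (hv i g).le
  have hp : ∀ g ∈ contested v X, ∀ j, g ∉ X j := fun g hg => (mem_contested.1 hg).1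
  -- `b` is the good in the bundle of the source that `k` likes less
  obtain ⟨a, b, hab, hsab, hvab⟩ : ∃ a b, a ≠ b ∧ X s = {a, b} ∧ v k b ≤ v k a := by
    obtain ⟨a, b, hab, he⟩ := Finset.card_eq_two.1 hsc
    rcases le_total (v k b) (v k a) with h | h
    · exact ⟨a, b, hab, he, h⟩
    · exact ⟨b, a, hab.symm, by rw [he, Finset.pair_comm], h⟩
  have has : a ∈ X s := by simp [hsab]
  have hbs : b ∈ X s := by simp [hsab]
  set T : Finset M := insert a (contested v X) with hTdef
  have hTB : T ⊆ X s ∪ contested v X :=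
    Finset.insert_subset (Finset.mem_union_left _ has) Finset.subset_union_right
  have hTc : T.card = 4 := by
    rw [hTdef, Finset.card_insert_of_notMem fun h => hp a h s has, hR]
  have hbk : 2 * v k b ≤ bundleValue v k (X k) := by
    have := hs.le_pair hsc hkc
    rw [hsab, bundleValue, Finset.sum_pair hab] at this
    linarith
  have hTk : bundleValue v k (X k) ≤ bundleValue v k T := by
    have h1 : X s ∪ contested v X = insert b T := by
      rw [hsab, hTdef, Finset.insert_comm]
      simp only [Finset.insert_union, Finset.singleton_union]
    have h2 := bundleValue_insert_le hv0 k b T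
    rw [← h1] at h2
    linarith
  have hpair : ∀ i, ∀ U ⊆ X s ∪ contested v X, U.card = 2 →
      ∑ x ∈ U, v i x ≤ 2 / 3 * level v i (X i) := by
    intro i U hU hUc
    have := hX.pair_le (hreach i) (T := U) (fun x hx => ?_) hUc
    · rw [bundleValue] at this
      linarith
    · exact (Finset.mem_union.1 (hU hx)).imp (fun h => ⟨h, hsc⟩) (hp x)
  obtain ⟨π, hπk, hπ⟩ := exists_perm_of_reflTransGen_envies (hreach k)
  obtain ⟨Y, hY⟩ : ∃ Y, Y = Function.update (X ∘ π) k T := ⟨_, rfl⟩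
  have hYk : Y k = T := by simp [hY]
  have hYj : ∀ j, j ≠ k → Y j = X (π j) := fun j hj => by simp [hY, hj]
  have hge : ∀ i, 2 * level v i (X i) ≤ 3 * bundleValue v i (Y i) := by
    intro i
    by_cases hi : i = k
    · rw [hi, level_of_card_eq_two hkc, hYk]
      linarith
    · have h1 := hπ i hi
      have h2 := level_le_bundleValue hv0 i (X (π i))
      rw [hYj i hi]
      linarith
  have hdisj : ∀ j, j ≠ k → Disjoint T (X (π j)) := by
    intro j hj
    have hne : π j ≠ s := fun e => hj (π.injective (e.trans hπk.symm))
    refine Finset.disjoint_left.2 fun x hx hx' => ?_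
    rcases Finset.mem_union.1 (hTB hx) with h' | h'
    · exact Finset.disjoint_left.1 (hX.disjoint _ _ hne) hx' h'
    · exact hp x h' _ hx'
  -- the goods that remain unallocated
  have hpool : ∀ g, (∀ j, g ∉ Y j) → g ∉ contested v X ∧ (g = b ∨ ∀ j, g ∉ X j) := by
    intro g hg
    have hgT : g ∉ T := hYk ▸ hg k
    refine ⟨fun h => hgT (Finset.mem_insert_of_mem h), ?_⟩
    by_contra! h
    obtain ⟨hgb, j, hj⟩ := h
    by_cases hjs : j = s
    · rw [hjs, hsab, Finset.mem_insert, Finset.mem_singleton] at hj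
      exact hgT (hTdef ▸ (hj.resolve_right hgb) ▸ Finset.mem_insert_self _ _)
    · have hne : π.symm j ≠ k := fun e => hjs (by rw [← hπk, ← e, π.apply_symm_apply])
      exact hg (π.symm j) (by rw [hYj _ hne, π.apply_symm_apply]; exact hj)
  have hcritY : ∀ g, (∀ j, g ∉ Y j) → ∀ i, IsCritical v Y g i → i = s ∧ g = b := by
    intro g hg i hi
    obtain ⟨hgR, hg'⟩ := hpool g hg
    unfold IsCritical at hi
    have hgei := hge i
    by_contra hne
    by_cases hik : i = k
    · subst hik
      rw [level_of_card_eq_two hkc] at hgei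
      rcases hg' with rfl | hg'
      · linarith
      · have := hX.not_isCritical_of_card hg' hkc
        linarith
    by_cases his : i = s
    · subst his
      rw [level_of_card_eq_two hsc] at hgei
      have := hX.not_isCritical_of_card (hg'.resolve_left fun e => hne ⟨rfl, e⟩) hsc
      linarith
    · -- the pair of `g` and a good `r` critical for `i` is worth at most two thirds of the bundle
      -- of `i`, so `g` is worth at most one sixth of it
      obtain ⟨r, hr, hri⟩ := hcrit i his hik
      have hgr : g ≠ r := fun e => hgR (e ▸ hr)
      have hc := hX.card_of_isCritical hv (hp r hr) hri
      have h1 := hX.pair_le (hreach i) (T := {g, r}) (by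
        intro x hx
        rw [Finset.mem_insert, Finset.mem_singleton] at hx
        rcases hx with rfl | rfl
        · rcases hg' with rfl | hg'
          · exact Or.inl ⟨hbs, hsc⟩
          · exact Or.inr hg'
        · exact Or.inr (hp _ hr)) (Finset.card_pair hgr)
      rw [level_of_card_le_one hc.le] at h1 hgei
      rw [bundleValue, Finset.sum_pair hgr] at h1
      unfold IsCritical at hri
      linarith [hv i g]
  refine ⟨Y, fun i j hij => ?_, fun i j hij x hx => ?_, fun g hg i i' hi hi' => ?_, ?_,
    fun C hC => ?_⟩
  · by_cases hi : i = k
    · subst hi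
      rw [hYk, hYj j hij.symm]
      exact hdisj j hij.symm
    · by_cases hj : j = k
      · subst hj
        rw [hYk, hYj i hij]
        exact (hdisj i hij).symm
      · rw [hYj i hi, hYj j hj]
        exact hX.disjoint _ _ (π.injective.ne hij)
  · have hgei := hge i
    by_cases hj : j = k
    · rw [hj, hYk] at hx ⊢
      have h1 := sum_le_of_card_le_three (hv0 i) (Z := X s ∪ contested v X)
        (hTc.ge.trans (Finset.card_le_card hTB) |>.trans' (by norm_num)) (hpair i)
        (T := T \ {x}) (Finset.sdiff_subset.trans hTB)
        (by rw [Finset.card_sdiff_of_subset (by simpa using hx), hTc]; simp)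
      rw [bundleValue]
      linarith
    · rw [hYj j hj] at hx ⊢
      have := hX.isTwoThirdsEFX_aux hv0 i (π j) hx
      linarith
  · rw [(hcritY g hg i hi).1, (hcritY g hg i' hi').1]
  · have hsub : Finset.univ.biUnion Y ⊆ Finset.univ.biUnion X ∪ contested v X := by
      refine Finset.biUnion_subset.2 fun j _ => ?_
      by_cases hj : j = k
      · rw [hj, hYk]
        exact hTB.trans (Finset.union_subset_union_left
          (Finset.subset_biUnion_of_mem X (Finset.mem_univ s)))
      · rw [hYj j hj]
        exact (Finset.subset_biUnion_of_mem X (Finset.mem_univ _)).trans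
          Finset.subset_union_left
    have h1 := (Finset.card_le_card hsub).trans (Finset.card_union_le _ _)
    have h2 := hX.card_biUnion_le hN
    omega
  · have : C ⊆ {b} := fun g hg => by
      obtain ⟨h1, i, hi⟩ := hC g hg
      exact Finset.mem_singleton.2 (hcritY g h1 i hi).2
    have := Finset.card_le_card this
    simp only [Finset.card_singleton] at this
    omega

end IsOptimal

end Cases

section Existence

variable {N M : Type*} [Fintype N] [DecidableEq N] [Fintype M] [DecidableEq M]
variable {v : N → M → ℝ} {X : N → Finset M}

namespace IsOptimal

/-- If there is only one source, then she takes all contested goods, unless an agent with a pair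
objects. In that case all agents are accounted for: every other agent has a critical good. -/
theorem exists_isNearSeed_of_unique_source (hX : IsOptimal v X) (hv : ∀ i g, 0 < v i g)
    (hN : Fintype.card N ≤ 8) (hR : (contested v X).card ≤ 3) {g₀ : M}
    (hg₀ : g₀ ∈ contested v X) {s : N} (hs : IsSource v X s)
    (hunique : ∀ t, IsSource v X t → t = s) : ∃ Z, IsNearSeed v Z := by
  classical
  have hv0 : ∀ i g, 0 ≤ v i g := fun i g => (hv i g).le
  have hp : ∀ g ∈ contested v X, ∀ j, g ∉ X j := fun g hg => (mem_contested.1 hg).1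
  have hp₀ := hp g₀ hg₀
  have hsc := hX.card_source hv hp₀ hs
  have hreach : ∀ i, Relation.ReflTransGen (Envies fun k j => level v k (X j)) s i := by
    intro i
    obtain ⟨t, ht, hts⟩ := hX.exists_source i
    exact hunique t hts ▸ ht
  have hA : attach v X (fun _ => s) s = X s ∪ contested v X := by simp [attach]
  have hBc : (X s ∪ contested v X).card = 2 + (contested v X).card := by
    rw [Finset.card_union_of_disjoint, hsc]
    exact Finset.disjoint_right.2 fun g hg => hp g hg s
  by_cases hobj : ∀ k, k ≠ s → ∀ x ∈ X s ∪ contested v X,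
      2 * bundleValue v k ((X s ∪ contested v X) \ {x}) ≤ 3 * bundleValue v k (X k)
  · refine ⟨_, hX.isNearSeed_attach hv hN hR (fun _ => s) ?_⟩
    rintro k j hkj ⟨g, -, rfl⟩ x hx
    rw [hA] at hx ⊢
    have h1 := hobj k hkj x hx
    have h2 : bundleValue v k (X k) ≤ bundleValue v k (attach v X (fun _ => s) k) :=
      bundleValue_mono hv0 k Finset.subset_union_left
    linarith
  · push Not at hobj
    obtain ⟨k, hks, x, hx, hlt⟩ := hobj
    have hpair : ∀ U ⊆ X s ∪ contested v X, U.card = 2 →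
        ∑ x ∈ U, v k x ≤ 2 / 3 * level v k (X k) := by
      intro U hU hUc
      have := hX.pair_le (hreach k) (T := U) (fun x hx => (Finset.mem_union.1 (hU hx)).imp
        (fun h => ⟨h, hsc⟩) (hp x)) hUc
      rw [bundleValue] at this
      linarith
    have hxc : ((X s ∪ contested v X) \ {x}).card = 1 + (contested v X).card := by
      rw [Finset.card_sdiff_of_subset (by simpa using hx), hBc, Finset.card_singleton]
      omega
    have h0 := bundleValue_nonneg hv0 k (X k)
    -- four goods are two pairs, which agents with a single good accept
    have hkc : (X k).card = 2 := by
      refine (hX.card_eq_one_or_two hv hp₀ k).resolve_left fun hc => ?_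
      have h1 := sum_le_of_card_le_four (hv0 k) (by omega) hpair
        (T := (X s ∪ contested v X) \ {x}) Finset.sdiff_subset (by omega)
      rw [level_of_card_le_one hc.le] at h1
      unfold bundleValue at *
      linarith
    -- three goods have half the value of their three pairs, which agents with a pair accept
    have hR3 : (contested v X).card = 3 := by
      by_contra hne
      have h1 := sum_le_of_card_le_three (hv0 k) (by omega) hpair
        (T := (X s ∪ contested v X) \ {x}) Finset.sdiff_subset (by omega)
      rw [level_of_card_eq_two hkc] at h1
      unfold bundleValue at *
      linarith
    -- two pairs and twice three agents with a critical good leave room for nobody else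
    have h1 := hX.card_contested hv
    have h2 : ({s, k} : Finset N) ⊆ Finset.univ.filter fun i => (X i).card = 2 := by
      intro i hi
      rw [Finset.mem_insert, Finset.mem_singleton] at hi
      rcases hi with rfl | rfl <;> simp [hsc, hkc]
    have h3 := Finset.card_le_card h2
    rw [Finset.card_pair hks.symm] at h3
    have h4 := Finset.card_le_univ (Finset.univ.filter fun i => (X i).card = 2 ∨
      ∃ g ∈ contested v X, IsCritical v X g i)
    have h5 := Finset.eq_of_subset_of_card_le h2 (by rw [Finset.card_pair hks.symm]; omega)
    have h6 := Finset.eq_univ_of_card (Finset.univ.filter fun i => (X i).card = 2 ∨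
      ∃ g ∈ contested v X, IsCritical v X g i) (by omega)
    refine hX.exists_isNearSeed_of_shift hv hN hR3 hks hs hreach hsc hkc (fun i his hik => ?_) ?_
    · refine (Finset.mem_filter.1 (h6 ▸ Finset.mem_univ i)).2.resolve_left fun hi => ?_
      have : i ∈ ({s, k} : Finset N) := h5 ▸ Finset.mem_filter.2 ⟨Finset.mem_univ i, hi⟩
      simp [his, hik] at this
    · have := bundleValue_mono hv0 k (Finset.sdiff_subset (s := X s ∪ contested v X) (t := {x}))
      linarith

theorem exists_isNearSeed [Nonempty N] (hX : IsOptimal v X) (hv : ∀ i g, 0 < v i g)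
    (hN : Fintype.card N ≤ 8) : ∃ Z, IsNearSeed v Z := by
  classical
  by_cases hR0 : contested v X = ∅
  · exact ⟨_, hX.isNearSeed_attach_of_injOn hv hN (by simp [hR0])
      (fun _ => Classical.arbitrary N) (by simp [hR0]) (by simp [hR0])⟩
  obtain ⟨g₀, hg₀⟩ := Finset.nonempty_iff_ne_empty.2 hR0
  have hp₀ := (mem_contested.1 hg₀).1
  obtain ⟨s, -, hs⟩ := hX.exists_source (Classical.arbitrary N)
  have h1 := hX.card_contested hv
  have h2 := Finset.card_le_univ (Finset.univ.filter fun i => (X i).card = 2 ∨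
    ∃ g ∈ contested v X, IsCritical v X g i)
  obtain ⟨S, hS⟩ : ∃ S : Finset N, S = Finset.univ.filter fun t => IsSource v X t := ⟨_, rfl⟩
  have hmem : ∀ t, t ∈ S ↔ IsSource v X t := by simp [hS]
  have hSc : S ⊆ Finset.univ.filter fun i => (X i).card = 2 := fun t ht =>
    Finset.mem_filter.2 ⟨Finset.mem_univ t, hX.card_source hv hp₀ ((hmem t).1 ht)⟩
  have h3 := Finset.card_le_card hSc
  have h4 : 0 < S.card := Finset.card_pos.2 ⟨s, (hmem s).2 hs⟩
  by_cases hle : (contested v X).card ≤ S.card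
  · obtain ⟨e⟩ := Function.Embedding.nonempty_of_card_le
      (α := contested v X) (β := S) (by simpa using hle)
    refine ⟨_, hX.isNearSeed_attach_of_injOn hv hN (by omega)
      (fun g => if h : g ∈ contested v X then e ⟨g, h⟩ else s) (fun g hg => ?_)
      fun g hg g' hg' h => ?_⟩
    · simpa [hg] using (hmem _).1 (e ⟨g, hg⟩).2
    · simp only [hg, hg', dite_true] at h
      exact congrArg Subtype.val (e.injective (Subtype.ext h))
  · by_cases hS1 : S.card = 1
    · obtain ⟨t, ht⟩ := Finset.card_eq_one.1 hS1
      have hall : ∀ t', IsSource v X t' → t' = t := fun t' ht' => by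
        have := (hmem t').2 ht'
        rwa [ht, Finset.mem_singleton] at this
      exact hX.exists_isNearSeed_of_unique_source hv hN (by omega) hg₀ hs fun t' ht' =>
        (hall t' ht').trans (hall s hs).symm
    · -- two sources and three contested goods: only the sources have pairs
      have hS2 : S.card = 2 := by omega
      obtain ⟨s, t, hst, he⟩ := Finset.card_eq_two.1 hS2
      have h5 := Finset.eq_of_subset_of_card_le hSc (by omega)
      obtain ⟨f, hf⟩ := hX.exists_isNearSeed_of_two_sources hv hN (by omega) hst
        ((hmem s).1 (by simp [he])) ((hmem t).1 (by simp [he])) fun k hk => by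
          have : k ∈ S := h5 ▸ Finset.mem_filter.2 ⟨Finset.mem_univ k, hk⟩
          simpa [he] using this
      exact ⟨_, hf⟩

end IsOptimal

/-! ### Existence of 2/3-EFX allocations -/

/-- Zero values are dealt with by a small perturbation: there are finitely many allocations, and the
conditions on a seed are closed. -/
theorem exists_isSeed [Nonempty N] (hv : ∀ i g, 0 ≤ v i g) (hN : Fintype.card N ≤ 8) :
    ∃ Z, IsSeed v Z := by
  classical
  by_contra! hno
  have hlim : ∀ k (S : Finset M), Filter.Tendsto
      (fun ε : ℝ => bundleValue (fun i g => v i g + ε) k S)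
      (nhdsWithin 0 (Set.Ioi 0)) (nhds (bundleValue v k S)) := by
    intro k S
    have : Continuous fun ε : ℝ => bundleValue (fun i g => v i g + ε) k S := by
      unfold bundleValue
      fun_prop
    simpa using (this.tendsto 0).mono_left nhdsWithin_le_nhds
  have key : ∀ Z : N → Finset M, ∀ᶠ ε in nhdsWithin (0 : ℝ) (Set.Ioi 0),
      ¬ IsSeed (fun i g => v i g + ε) Z := by
    intro Z
    by_contra hf
    refine hno Z ?_
    have hf' : ∃ᶠ ε in nhdsWithin (0 : ℝ) (Set.Ioi 0), IsSeed (fun i g => v i g + ε) Z := hf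
    obtain ⟨ε₀, h₀⟩ := hf'.exists
    refine ⟨h₀.disjoint, fun k j hkj g hg => ?_, fun g hg k => ?_, h₀.card_le⟩
    · exact le_of_tendsto_of_tendsto_of_frequently ((hlim k (Z j \ {g})).const_mul 2)
        ((hlim k (Z k)).const_mul 3) (hf'.mono fun ε h => h.efx k j hkj g hg)
    · have h1 := hlim k {g}
      simp only [bundleValue, Finset.sum_singleton] at h1
      exact le_of_tendsto_of_tendsto_of_frequently (h1.const_mul 2)
        (hlim k (Z k)) (hf'.mono fun ε h => h.not_critical g hg k)
  obtain ⟨ε, hε, hpos⟩ := ((Filter.eventually_all.2 key).and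
    (eventually_mem_nhdsWithin (a := (0 : ℝ)) (s := Set.Ioi 0))).exists
  have hpos' : ∀ i g, 0 < v i g + ε := fun i g => add_pos_of_nonneg_of_pos (hv i g) hpos
  obtain ⟨X, hX⟩ := exists_isOptimal fun i g => v i g + ε
  obtain ⟨Z, hZ⟩ := hX.exists_isNearSeed hpos' hN
  obtain ⟨Y, hY⟩ := hZ.exists_isSeed fun i g => (hpos' i g).le
  exact hε Y hY

/-- Envy-cycle elimination, started from a seed. -/
theorem exists_isTwoThirdsEFX [Nonempty N] (hv : ∀ i g, 0 ≤ v i g) (hN : Fintype.card N ≤ 8) :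
    ∃ X : N → Finset M, IsAllocation X ∧ IsTwoThirdsEFX v X := by
  classical
  suffices key : ∀ (c : ℕ) (Z : N → Finset M), IsPartialAllocation Z → IsTwoThirdsEFX v Z →
      (∀ g, (∀ j, g ∉ Z j) → ∀ k, 2 * v k g ≤ bundleValue v k (Z k)) →
      (Finset.univ.filter fun g => ∀ j, g ∉ Z j).card ≤ c →
      ∃ X : N → Finset M, IsAllocation X ∧ IsTwoThirdsEFX v X by
    obtain ⟨Z, hZ⟩ := exists_isSeed hv hN
    exact key _ Z hZ.disjoint hZ.efx hZ.not_critical le_rfl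
  intro c
  induction c with
  | zero =>
    refine fun Z h1 h2 _ h4 => ⟨Z, ⟨h1, fun g => ?_⟩, h2⟩
    by_contra! hg
    have := Finset.card_eq_zero.1 (Nat.le_zero.1 h4)
    exact Finset.notMem_empty g (this ▸ Finset.mem_filter.2 ⟨Finset.mem_univ g, hg⟩)
  | succ c ih =>
    intro Z h1 h2 h3 h4
    by_cases hex : ∃ g, ∀ j, g ∉ Z j
    · obtain ⟨g, hg⟩ := hex
      obtain ⟨π, s, hE, hge⟩ := exists_permuteAdd hv h2 inferInstance (g := g)
        fun k k' hk => absurd hk (not_lt.2 (h3 g hg k))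
      have hpool : ∀ x, (∀ j, x ∉ permuteAdd Z π s g j) → ∀ j, x ∉ Z j := fun x hx j hj =>
        hx (π.symm j) (subset_permuteAdd Z π s g _ (by simpa using hj))
      refine ih _ (isPartialAllocation_permuteAdd h1 hg π s) hE
        (fun x hx k => (h3 x (hpool x hx) k).trans (hge k)) ?_
      have hsub : (Finset.univ.filter fun x => ∀ j, x ∉ permuteAdd Z π s g j) ⊂
          Finset.univ.filter fun x => ∀ j, x ∉ Z j := by
        refine Finset.ssubset_iff_subset_ne.2 ⟨fun x hx => ?_, fun e => ?_⟩
        · exact Finset.mem_filter.2 ⟨Finset.mem_univ x, hpool x (Finset.mem_filter.1 hx).2⟩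
        · have : g ∈ Finset.univ.filter fun x => ∀ j, x ∉ Z j :=
            Finset.mem_filter.2 ⟨Finset.mem_univ g, hg⟩
          rw [← e] at this
          exact (Finset.mem_filter.1 this).2 s (mem_permuteAdd.2 (Or.inr ⟨rfl, rfl⟩))
      have := Finset.card_lt_card hsub
      omega
    · push Not at hex
      exact ⟨Z, ⟨h1, hex⟩, h2⟩

end Existence

/-! ### Allocations as tables of owners, and the search space -/

section Owners

open Finset

/-- The total weight, for agent `i`, of the goods below `m` whose owner in the table `σ` is `j`. -/
def ownedWeight (m : ℕ) (w σ : ℕ → ℕ) (i j : ℕ) : ℕ :=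
  ∑ u ∈ range m, if σ u = j then w (i * m + u) else 0

/-- The conditions of the test below for agent `i` and good `u`. -/
def IsGoodAt (n m : ℕ) (w : ℕ → ℕ) (r : ℕ) (σ : ℕ → ℕ) (i u : ℕ) : Prop :=
  (σ u < n → 2 * ownedWeight m w σ i (σ u) ≤ 3 * ownedWeight m w σ i i + 2 * w (i * m + u)) ∧
  (n ≤ σ u → r ≤ u ∧ 2 * w (i * m + u) ≤ ownedWeight m w σ i i)

/-- The test of a table `σ` of owners, in which a number `≥ n` marks an unallocated good: the
partial allocation is `2/3`-EFX, no unallocated good is critical, and all goods below `r` are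
allocated. -/
def IsGood (n m : ℕ) (w : ℕ → ℕ) (r : ℕ) (σ : ℕ → ℕ) : Prop :=
  ∀ i < n, ∀ u < m, IsGoodAt n m w r σ i u

theorem ownedWeight_congr {m : ℕ} {w σ τ : ℕ → ℕ} (h : ∀ u < m, σ u = τ u) (i j : ℕ) :
    ownedWeight m w σ i j = ownedWeight m w τ i j :=
  Finset.sum_congr rfl fun u hu => by rw [h u (Finset.mem_range.1 hu)]

theorem IsGood.congr {n m r : ℕ} {w σ τ : ℕ → ℕ} (hσ : IsGood n m w r σ)
    (h : ∀ u < m, σ u = τ u) : IsGood n m w r τ := by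
  intro i hi u hu
  rw [IsGoodAt, ← h u hu, ← ownedWeight_congr h, ← ownedWeight_congr h]
  exact hσ i hi u hu

/-- The bundles described by a table of owners. -/
def ownerBundles (n m : ℕ) (σ : ℕ → ℕ) (i : Fin n) : Finset (Fin m) :=
  univ.filter fun g => σ g = i

/-- The valuations described by a table of weights. -/
def weightValue (n m : ℕ) (w : ℕ → ℕ) (i : Fin n) (g : Fin m) : ℝ := w (i * m + g)

theorem mem_ownerBundles {n m : ℕ} {σ : ℕ → ℕ} {i : Fin n} {g : Fin m} :
    g ∈ ownerBundles n m σ i ↔ σ g = i := by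
  simp [ownerBundles]

theorem weightValue_nonneg {n m : ℕ} {w : ℕ → ℕ} (i : Fin n) (g : Fin m) :
    0 ≤ weightValue n m w i g := Nat.cast_nonneg _

theorem isPartialAllocation_ownerBundles (n m : ℕ) (σ : ℕ → ℕ) :
    IsPartialAllocation (ownerBundles n m σ) := by
  intro i j hij
  refine disjoint_left.2 fun g hg hg' => hij (Fin.ext ?_)
  rw [← mem_ownerBundles.1 hg, mem_ownerBundles.1 hg']

theorem notMem_ownerBundles {n m : ℕ} {σ : ℕ → ℕ} {g : Fin m} :
    (∀ j, g ∉ ownerBundles n m σ j) ↔ n ≤ σ g := by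
  simp only [mem_ownerBundles]
  constructor
  · intro h
    by_contra! hlt
    exact h ⟨_, hlt⟩ rfl
  · intro h j hj
    have := j.2
    omega

theorem bundleValue_ownerBundles (n m : ℕ) (w σ : ℕ → ℕ) (i j : Fin n) :
    bundleValue (weightValue n m w) i (ownerBundles n m σ j) = ownedWeight m w σ i j := by
  rw [bundleValue, ownerBundles, ownedWeight, Finset.sum_range, Finset.sum_filter]
  push_cast
  rfl

theorem isGood_iff {n m : ℕ} (hn : 1 ≤ n) {w : ℕ → ℕ} {r : ℕ} {σ : ℕ → ℕ} :
    IsGood n m w r σ ↔ IsTwoThirdsEFX (weightValue n m w) (ownerBundles n m σ) ∧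
      ∀ g, (∀ j, g ∉ ownerBundles n m σ j) → r ≤ g ∧ ∀ k, 2 * weightValue n m w k g ≤
        bundleValue (weightValue n m w) k (ownerBundles n m σ k) := by
  have hsplit : ∀ (k j : Fin n) (g : Fin m), g ∈ ownerBundles n m σ j →
      bundleValue (weightValue n m w) k (ownerBundles n m σ j \ {g}) + w (k * m + g) =
        ownedWeight m w σ k j := by
    intro k j g hg
    have h := Finset.sum_sdiff (f := weightValue n m w k) (Finset.singleton_subset_iff.2 hg)
    rw [Finset.sum_singleton] at h
    rw [← bundleValue_ownerBundles]
    exact h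
  constructor
  · refine fun h => ⟨fun k j _ g hg => ?_, fun g hg => ?_⟩
    · have h1 := (h k k.2 g g.2).1 (by rw [mem_ownerBundles.1 hg]; exact j.2)
      have h2 := hsplit k j g hg
      rw [mem_ownerBundles.1 hg] at h1
      have h3 : (2 * ownedWeight m w σ k j : ℝ) ≤ 3 * ownedWeight m w σ k k + 2 * w (k * m + g) :=
        mod_cast h1
      rw [bundleValue_ownerBundles]
      linarith
    · have hg' := notMem_ownerBundles.1 hg
      refine ⟨((h 0 hn g g.2).2 hg').1, fun k => ?_⟩
      rw [bundleValue_ownerBundles, weightValue]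
      exact mod_cast ((h k k.2 g g.2).2 hg').2
  · rintro ⟨h1, h2⟩ i hi u hu
    refine ⟨fun hσ => ?_, fun hσ => ?_⟩
    · by_cases hij : i = σ u
      · rw [← hij]
        omega
      · have hmem : (⟨u, hu⟩ : Fin m) ∈ ownerBundles n m σ ⟨σ u, hσ⟩ := mem_ownerBundles.2 rfl
        have h3 := h1 ⟨i, hi⟩ ⟨σ u, hσ⟩ (by simpa using hij) ⟨u, hu⟩ hmem
        have h4 := hsplit ⟨i, hi⟩ ⟨σ u, hσ⟩ ⟨u, hu⟩ hmem
        rw [bundleValue_ownerBundles] at h3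
        have h5 : (2 * ownedWeight m w σ i (σ u) : ℝ) ≤
            3 * ownedWeight m w σ i i + 2 * w (i * m + u) := by
          simp only at h3 h4
          linarith
        exact mod_cast h5
    · have h3 := h2 ⟨u, hu⟩ (notMem_ownerBundles.2 hσ)
      refine ⟨h3.1, ?_⟩
      have h4 := h3.2 ⟨i, hi⟩
      rw [bundleValue_ownerBundles] at h4
      unfold weightValue at h4
      exact mod_cast h4

/-- Change the table `τ` in `k` places: address and new owner of each change are read off from the
number `x`, in bases `m + 1` and `n`. The address `m`, which belongs to no good, can be used for
idle changes. -/
def applyChanges (n m : ℕ) : ℕ → ℕ → (ℕ → ℕ) → ℕ → ℕ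
  | 0, _, τ => τ
  | k + 1, x, τ => applyChanges n m k (x / (m + 1) / n)
      (Function.update τ (x % (m + 1)) (x / (m + 1) % n))

/-- The candidate with number `c` for the successor of a table `σ`: the owners are renamed by the
first `n` digits of `c` in base `n`, and the rest of `c` describes 27 changes. -/
def candidate (n m : ℕ) (σ : ℕ → ℕ) (c : ℕ) : ℕ → ℕ :=
  applyChanges n m 27 (c / n ^ n) fun u => if σ u < n then c / n ^ σ u % n else n

theorem exists_digits {n : ℕ} (k : ℕ) (d : ℕ → ℕ) (hd : ∀ i < k, d i < n) (x : ℕ) :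
    ∃ c < n ^ k * (x + 1), c / n ^ k = x ∧ ∀ i < k, c / n ^ i % n = d i := by
  induction k generalizing d with
  | zero => exact ⟨x, by simp, by simp, by simp⟩
  | succ k ih =>
    have hn : 0 < n := (Nat.zero_le _).trans_lt (hd 0 k.succ_pos)
    obtain ⟨c, h1, h2, h3⟩ := ih (fun i => d (i + 1)) fun i hi => hd (i + 1) (by omega)
    have hdiv : (d 0 + n * c) / n = c := by
      rw [Nat.add_mul_div_left _ _ hn, Nat.div_eq_of_lt (hd 0 k.succ_pos), Nat.zero_add]
    have hstep : ∀ i, (d 0 + n * c) / n ^ (i + 1) = c / n ^ i := fun i => by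
      rw [pow_succ', ← Nat.div_div_eq_div_mul, hdiv]
    refine ⟨d 0 + n * c, ?_, (hstep k).trans h2, fun i hi => ?_⟩
    · have h0 := hd 0 k.succ_pos
      have h4 : n * (c + 1) ≤ n * (n ^ k * (x + 1)) := Nat.mul_le_mul_left n h1
      rw [pow_succ', mul_assoc]
      rw [mul_add] at h4
      omega
    · cases i with
      | zero => simp [Nat.mod_eq_of_lt (hd 0 k.succ_pos)]
      | succ i => rw [hstep]; exact h3 i (by omega)

theorem exists_changes {n m : ℕ} (hn : 0 < n) (b : ℕ → ℕ) (k : ℕ) (A : Finset ℕ)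
    (hA : ∀ u ∈ A, u < m ∧ b u < n) (hk : A.card ≤ k) :
    ∃ x < ((m + 1) * n) ^ k, ∀ τ, ∀ u < m,
      applyChanges n m k x τ u = if u ∈ A then b u else τ u := by
  induction k generalizing A with
  | zero =>
    refine ⟨0, by simp, fun τ u _ => ?_⟩
    simp [Finset.card_eq_zero.1 (Nat.le_zero.1 hk), applyChanges]
  | succ k ih =>
    -- the next change: an element of `A`, or an idle one
    obtain ⟨a, y, A', ha, hy, hA', hc, hstep⟩ : ∃ (a y : ℕ) (A' : Finset ℕ), a ≤ m ∧ y < n ∧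
        (∀ u ∈ A', u < m ∧ b u < n) ∧ A'.card ≤ k ∧ ∀ τ : ℕ → ℕ, ∀ u < m,
          (if u ∈ A' then b u else Function.update τ a y u) = if u ∈ A then b u else τ u := by
      by_cases he : A = ∅
      · refine ⟨m, 0, ∅, le_rfl, hn, by simp, by simp, fun τ u hu => ?_⟩
        simp [he, hu.ne]
      · obtain ⟨a, ha⟩ := Finset.nonempty_iff_ne_empty.2 he
        refine ⟨a, b a, A.erase a, (hA a ha).1.le, (hA a ha).2,
          fun u hu => hA u (Finset.mem_of_mem_erase hu), ?_, fun τ u hu => ?_⟩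
        · rw [Finset.card_erase_of_mem ha]
          omega
        · by_cases hua : u = a
          · subst hua; simp [ha]
          · simp [hua]
    obtain ⟨x, hx, hx'⟩ := ih A' hA' hc
    have h1 : (a + (m + 1) * (y + n * x)) % (m + 1) = a := by
      rw [Nat.add_mul_mod_self_left, Nat.mod_eq_of_lt (by omega)]
    have h2 : (a + (m + 1) * (y + n * x)) / (m + 1) = y + n * x := by
      rw [Nat.add_mul_div_left _ _ m.succ_pos, Nat.div_eq_of_lt (by omega), Nat.zero_add]
    have h3 : (y + n * x) % n = y := by
      rw [Nat.add_mul_mod_self_left, Nat.mod_eq_of_lt hy]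
    have h4 : (y + n * x) / n = x := by
      rw [Nat.add_mul_div_left _ _ hn, Nat.div_eq_of_lt hy, Nat.zero_add]
    refine ⟨a + (m + 1) * (y + n * x), ?_, fun τ u hu => ?_⟩
    · have h5 : n * (x + 1) ≤ n * ((m + 1) * n) ^ k := Nat.mul_le_mul_left n hx
      have h6 : (m + 1) * (y + n * x + 1) ≤ (m + 1) * (n * ((m + 1) * n) ^ k) :=
        Nat.mul_le_mul_left _ (by rw [mul_add] at h5; omega)
      rw [pow_succ', mul_assoc]
      rw [mul_add] at h6
      omega
    · rw [applyChanges, h1, h2, h3, h4, hx' _ u hu]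
      exact hstep τ u hu

/-- The number of candidates that are tried. -/
def candidateCount (n m : ℕ) : ℕ := n ^ n * ((m + 1) * n) ^ 27

theorem exists_candidate {n m : ℕ} (hn : 0 < n) (ρ b : ℕ → ℕ) (hρ : ∀ i < n, ρ i < n)
    (A : Finset ℕ) (hA : ∀ u ∈ A, u < m ∧ b u < n) (hk : A.card ≤ 27) :
    ∃ c < candidateCount n m, ∀ σ : ℕ → ℕ, ∀ u < m,
      candidate n m σ c u = if u ∈ A then b u else if σ u < n then ρ (σ u) else n := by
  obtain ⟨x, hx, hx'⟩ := exists_changes hn b 27 A hA hk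
  obtain ⟨c, h1, h2, h3⟩ := exists_digits n ρ hρ x
  refine ⟨c, h1.trans_le (Nat.mul_le_mul_left _ hx), fun σ u hu => ?_⟩
  rw [candidate, h2, hx' _ u hu]
  by_cases hσ : σ u < n
  · simp [hσ, h3 _ hσ]
  · simp [hσ]

theorem applyChanges_le {n m : ℕ} (hn : 0 < n) (k x : ℕ) (τ : ℕ → ℕ) (hτ : ∀ u, τ u ≤ n) (u : ℕ) :
    applyChanges n m k x τ u ≤ n := by
  induction k generalizing x τ with
  | zero => exact hτ u
  | succ k ih =>
    refine ih _ _ fun u' => ?_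
    by_cases h : u' = x % (m + 1)
    · subst h
      simpa using (Nat.mod_lt _ hn).le
    · simpa [h] using hτ u'

theorem candidate_le {n m : ℕ} (hn : 0 < n) (σ : ℕ → ℕ) (c u : ℕ) : candidate n m σ c u ≤ n := by
  refine applyChanges_le hn _ _ _ (fun u => ?_) u
  split_ifs
  · exact (Nat.mod_lt _ hn).le
  · exact le_rfl

theorem applyChanges_congr {n m : ℕ} (k x : ℕ) {τ τ' : ℕ → ℕ} (h : ∀ u < m, τ u = τ' u) :
    ∀ u < m, applyChanges n m k x τ u = applyChanges n m k x τ' u := by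
  induction k generalizing x τ τ' with
  | zero => exact h
  | succ k ih =>
    refine ih _ fun u hu => ?_
    by_cases hu' : u = x % (m + 1)
    · subst hu'; simp
    · simpa [hu'] using h u hu

/-- The first search finds a seed. -/
theorem exists_candidate_isGood_zero {n m : ℕ} (hn : 1 ≤ n) (hn8 : n ≤ 8) (w : ℕ → ℕ) :
    ∃ c < candidateCount n m, ∀ σ : ℕ → ℕ, (∀ u < m, σ u = n) →
      IsGood n m w 0 (candidate n m σ c) := by
  classical
  have : Nonempty (Fin n) := ⟨⟨0, hn⟩⟩
  obtain ⟨Z, hZ⟩ := exists_isSeed (v := weightValue n m w) weightValue_nonneg (by simpa using hn8)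
  obtain ⟨b, hb⟩ : ∃ b : ℕ → ℕ, ∀ (g : Fin m) (i : Fin n), g ∈ Z i → b g = i := by
    refine ⟨fun u => if h : ∃ (i : Fin n) (g : Fin m), g.1 = u ∧ g ∈ Z i then h.choose else 0,
      fun g i hg => ?_⟩
    have h : ∃ (i : Fin n) (g' : Fin m), g'.1 = g.1 ∧ g' ∈ Z i := ⟨i, g, rfl, hg⟩
    obtain ⟨g', h1, h2⟩ := h.choose_spec
    beta_reduce
    rw [dif_pos h]
    by_contra hne
    rw [Fin.ext h1] at h2
    exact disjoint_left.1 (hZ.disjoint _ _ fun e => hne (congrArg Fin.val e)) h2 hg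
  have hA : ∀ u, u ∈ (univ.biUnion Z).map Fin.valEmbedding ↔
      ∃ (i : Fin n) (g : Fin m), g.1 = u ∧ g ∈ Z i := by
    intro u
    simp only [mem_map, mem_biUnion, mem_univ, true_and, Fin.valEmbedding_apply]
    constructor
    · rintro ⟨g, ⟨i, hg⟩, rfl⟩
      exact ⟨i, g, rfl, hg⟩
    · rintro ⟨i, g, rfl, hg⟩
      exact ⟨g, ⟨i, hg⟩, rfl⟩
  obtain ⟨c, hc, hc'⟩ := exists_candidate (m := m) hn id b (fun i hi => hi)
    ((univ.biUnion Z).map Fin.valEmbedding) (fun u hu => by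
      obtain ⟨i, g, rfl, hg⟩ := (hA u).1 hu
      exact ⟨g.2, by rw [hb g i hg]; exact i.2⟩) (by rw [card_map]; exact hZ.card_le)
  refine ⟨c, hc, fun σ hσ => (isGood_iff hn).2 ?_⟩
  have e : ownerBundles n m (candidate n m σ c) = Z := by
    ext i g
    rw [mem_ownerBundles, hc' σ g g.2]
    by_cases hg : g.1 ∈ (univ.biUnion Z).map Fin.valEmbedding
    · rw [if_pos hg]
      obtain ⟨i', g', h1, h2⟩ := (hA _).1 hg
      rw [Fin.ext h1] at h2
      rw [hb g i' h2]
      constructor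
      · intro h
        rwa [← Fin.ext h]
      · intro h
        by_contra hne
        exact disjoint_left.1 (hZ.disjoint _ _ fun e => hne (congrArg Fin.val e)) h2 h
    · rw [if_neg hg, hσ g g.2, if_neg (lt_irrefl n)]
      refine ⟨fun h => absurd h (i.2.ne'), fun h => absurd ((hA _).2 ⟨i, g, rfl, h⟩) hg⟩
  rw [e]
  exact ⟨hZ.efx, fun g hg => ⟨Nat.zero_le _, hZ.not_critical g hg⟩⟩

/-- The later searches find a table in which one more good is allocated. -/
theorem exists_candidate_isGood_succ {n m r : ℕ} (hn : 1 ≤ n) (hr : r < m) {w σ : ℕ → ℕ}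
    (hσ : IsGood n m w r σ) :
    ∃ c < candidateCount n m, IsGood n m w (r + 1) (candidate n m σ c) := by
  obtain ⟨h1, h2⟩ := (isGood_iff hn).1 hσ
  by_cases hrσ : σ r < n
  · -- good `r` is already allocated
    obtain ⟨c, hc, hc'⟩ := exists_candidate (m := m) hn id id (fun i hi => hi) ∅ (by simp)
      (by simp)
    refine ⟨c, hc, (isGood_iff hn).2 ?_⟩
    have e : ownerBundles n m (candidate n m σ c) = ownerBundles n m σ := by
      ext i g
      rw [mem_ownerBundles, mem_ownerBundles, hc' σ g g.2]
      have := i.2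
      simp only [notMem_empty, if_false, id]
      split_ifs <;> omega
    rw [e]
    refine ⟨h1, fun g hg => ⟨?_, (h2 g hg).2⟩⟩
    have h3 := (h2 g hg).1
    have h4 := notMem_ownerBundles.1 hg
    by_contra hlt
    rw [show g.1 = r by omega] at h4
    omega
  · have hg : ∀ j, (⟨r, hr⟩ : Fin m) ∉ ownerBundles n m σ j := notMem_ownerBundles.2 (not_lt.1 hrσ)
    obtain ⟨π, s, h3, h4⟩ := exists_permuteAdd weightValue_nonneg h1 ⟨⟨0, hn⟩⟩ (g := ⟨r, hr⟩)
      fun k k' hk => absurd hk (not_lt.2 ((h2 _ hg).2 k))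
    obtain ⟨c, hc, hc'⟩ := exists_candidate (m := m) hn
      (fun i => if h : i < n then (π.symm ⟨i, h⟩).1 else 0) (fun _ => s)
      (fun i hi => by simp [hi]) {r} (by simpa using hr) (by simp)
    refine ⟨c, hc, (isGood_iff hn).2 ?_⟩
    have e : ownerBundles n m (candidate n m σ c) =
        permuteAdd (ownerBundles n m σ) π s ⟨r, hr⟩ := by
      ext i g
      rw [mem_ownerBundles, mem_permuteAdd, hc' σ g g.2, mem_ownerBundles]
      simp only [mem_singleton]
      by_cases hgr : g.1 = r
      · have hgr' : g = ⟨r, hr⟩ := Fin.ext hgr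
        have hne : σ r ≠ π i := by have := (π i).2; omega
        simp [hgr', hne, Fin.ext_iff, eq_comm]
      · have hgr' : g ≠ ⟨r, hr⟩ := fun e => hgr (congrArg Fin.val e)
        simp only [hgr, hgr', if_false, and_false, or_false]
        by_cases hlt : σ g < n
        · simp only [hlt, if_true, dite_true]
          rw [Fin.val_inj, Equiv.symm_apply_eq, Fin.ext_iff]
        · have h5 := i.2
          have h6 := (π i).2
          simp only [hlt, if_false]
          omega
    rw [e]
    refine ⟨h3, fun g hg' => ?_⟩
    have hg'' : ∀ j, g ∉ ownerBundles n m σ j := fun j hj =>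
      hg' (π.symm j) (subset_permuteAdd _ π s _ _ (by simpa using hj))
    refine ⟨?_, fun k => ((h2 g hg'').2 k).trans (h4 k)⟩
    have h5 := (h2 g hg'').1
    have h6 : g.1 ≠ r := fun e' => hg' s (mem_permuteAdd.2 (Or.inr ⟨rfl, Fin.ext e'⟩))
    omega

end Owners

end FairDivision

/-! ### Reasoning about programs -/

namespace RAM

/-- The weight of an expression bounds the growth of bit lengths and the cost in its evaluation. -/
def Expr.weight : Expr → ℕ
  | .const c => c + 1
  | .reg _ => 1
  | .get _ e => e.weight + 1
  | .add e₁ e₂ => e₁.weight + e₂.weight + 1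
  | .sub e₁ e₂ => e₁.weight + e₂.weight + 1
  | .mul e₁ e₂ => e₁.weight + e₂.weight + 1
  | .div e₁ e₂ => e₁.weight + e₂.weight + 1

/-- All numbers in the store have at most `B` bits. -/
def State.Bounded (B : ℕ) (s : State) : Prop :=
  (∀ r, s.reg r < 2 ^ B) ∧ ∀ k a, s.arr k a < 2 ^ B

theorem Expr.one_le_weight (e : Expr) : 1 ≤ e.weight := by
  cases e <;> simp [weight]

theorem Expr.val_lt {B : ℕ} {s : State} (hs : s.Bounded B) (e : Expr) :
    e.val s < 2 ^ (e.weight * (B + 1)) := by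
  have hmono : ∀ {a b x : ℕ}, a ≤ b → x < 2 ^ a → x < 2 ^ b := fun hab hx =>
    hx.trans_le (Nat.pow_le_pow_right (by norm_num) hab)
  have hexp : ∀ a b : ℕ, (a + b + 1) * (B + 1) = a * (B + 1) + b * (B + 1) + B + 1 := by
    intros; ring
  induction e with
  | const c =>
    refine hmono (a := c) ?_ Nat.lt_two_pow_self
    simp only [weight]
    nlinarith
  | reg r => exact hmono (by simp [weight]) (hs.1 r)
  | get k e _ =>
    refine hmono (a := B) ?_ (hs.2 k _)
    simp only [weight]
    nlinarith
  | add e₁ e₂ h₁ h₂ =>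
    have h1 := hmono (Nat.le_add_right _ (e₂.weight * (B + 1))) h₁
    have h2 := hmono (Nat.le_add_left _ (e₁.weight * (B + 1))) h₂
    refine hmono (a := e₁.weight * (B + 1) + e₂.weight * (B + 1) + 1) ?_ ?_
    · simp only [weight, hexp]; omega
    · rw [pow_succ]; simp only [val]; omega
  | sub e₁ e₂ h₁ _ =>
    refine hmono (a := e₁.weight * (B + 1)) ?_ ((Nat.sub_le _ _).trans_lt h₁)
    simp only [weight, hexp]; omega
  | mul e₁ e₂ h₁ h₂ =>
    refine hmono (a := e₁.weight * (B + 1) + e₂.weight * (B + 1)) ?_ ?_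
    · simp only [weight, hexp]; omega
    · rw [pow_add]
      exact Nat.mul_lt_mul'' h₁ h₂
  | div e₁ e₂ h₁ _ =>
    refine hmono (a := e₁.weight * (B + 1)) ?_ ((Nat.div_le_self _ _).trans_lt h₁)
    simp only [weight, hexp]; omega

theorem Expr.cost_le {B : ℕ} {s : State} (hs : s.Bounded B) (e : Expr) :
    e.cost s ≤ e.weight ^ 2 * (B + 1) := by
  have hop : ∀ (e e₁ e₂ : Expr), e.weight = e₁.weight + e₂.weight + 1 →
      e₁.cost s ≤ e₁.weight ^ 2 * (B + 1) → e₂.cost s ≤ e₂.weight ^ 2 * (B + 1) →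
      e₁.cost s + e₂.cost s + (1 + Nat.size (e.val s)) ≤ e.weight ^ 2 * (B + 1) := by
    intro e e₁ e₂ he h₁ h₂
    have h3 := Nat.size_le.2 (e.val_lt hs)
    have h4 := e₁.one_le_weight
    have h5 := e₂.one_le_weight
    have h6 : 1 ≤ e₁.weight * e₂.weight * (B + 1) :=
      Nat.one_le_iff_ne_zero.2 (by positivity)
    rw [he] at h3 ⊢
    nlinarith
  induction e with
  | const c =>
    have h := Nat.size_le.2 (show c < 2 ^ c from Nat.lt_two_pow_self)
    simp only [cost, weight]
    nlinarith
  | reg r =>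
    have h := Nat.size_le.2 (hs.1 r)
    simp only [cost, weight]
    omega
  | get k e h =>
    have h1 := Nat.size_le.2 (hs.2 k (e.val s))
    have h2 : (e.weight + 1) ^ 2 * (B + 1) =
        e.weight ^ 2 * (B + 1) + 2 * e.weight * (B + 1) + (B + 1) := by ring
    simp only [cost, weight]
    omega
  | add e₁ e₂ h₁ h₂ => exact hop (.add e₁ e₂) e₁ e₂ rfl h₁ h₂
  | sub e₁ e₂ h₁ h₂ => exact hop (.sub e₁ e₂) e₁ e₂ rfl h₁ h₂
  | mul e₁ e₂ h₁ h₂ => exact hop (.mul e₁ e₂) e₁ e₂ rfl h₁ h₂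
  | div e₁ e₂ h₁ h₂ => exact hop (.div e₁ e₂) e₁ e₂ rfl h₁ h₂

/-- From a state with numbers of at most `B` bits, the program `c` halts in such a state, which
satisfies `Q`; it makes at most `T` elementary steps, each of cost at most `5000 * (B + 1)`. -/
def Runs (B : ℕ) (c : Cmd) (s : State) (T : ℕ) (Q : State → Prop) : Prop :=
  s.Bounded B → ∃ s' t, Exec c s s' t ∧ t ≤ T * (5000 * (B + 1)) ∧ s'.Bounded B ∧ Q s'

namespace Runs

variable {B T T₁ T₂ : ℕ} {s : State} {Q Q' : State → Prop}

theorem mono {c : Cmd} (h : Runs B c s T₁ Q) (hT : T₁ ≤ T₂) (hQ : ∀ s', Q s' → Q' s') :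
    Runs B c s T₂ Q' := by
  intro hs
  obtain ⟨s', t, h1, h2, h3, h4⟩ := h hs
  exact ⟨s', t, h1, h2.trans (Nat.mul_le_mul_right _ hT), h3, hQ _ h4⟩

theorem of_bounded {c : Cmd} (h : s.Bounded B → Runs B c s T Q) : Runs B c s T Q :=
  fun hs => h hs hs

theorem step_le (hs : s.Bounded B) (e : Expr) (he : e.weight ≤ 50) :
    1 + e.cost s ≤ 2501 * (B + 1) := by
  have h1 := e.cost_le hs
  have h2 : e.weight ^ 2 ≤ 2500 := Nat.pow_le_pow_left he 2
  have h3 := Nat.mul_le_mul_right (B + 1) h2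
  omega

theorem assign {r : ℕ} {e : Expr} (hlt : e.val s < 2 ^ B) (hQ : Q (s.setReg r (e.val s)))
    (he : e.weight ≤ 50 := by decide) : Runs B (.assign r e) s 1 Q := by
  intro hs
  refine ⟨_, _, Exec.assign r e s, ?_, ⟨fun r' => ?_, hs.2⟩, hQ⟩
  · have := step_le hs e he
    linarith
  · by_cases h : r' = r
    · subst h; simpa [State.setReg] using hlt
    · simpa [State.setReg, h] using hs.1 r'

theorem put {k : ℕ} {e₁ e₂ : Expr} (hlt : e₂.val s < 2 ^ B)
    (hQ : Q (s.setArr k (e₁.val s) (e₂.val s))) (he₁ : e₁.weight ≤ 40 := by decide)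
    (he₂ : e₂.weight ≤ 50 := by decide) : Runs B (.put k e₁ e₂) s 1 Q := by
  intro hs
  refine ⟨_, _, Exec.put k e₁ e₂ s, ?_, ⟨hs.1, fun k' a => ?_⟩, hQ⟩
  · have h1 := step_le hs e₁ (by omega)
    have h2 := step_le hs e₂ he₂
    have h3 := e₁.cost_le hs
    have h4 : e₁.weight ^ 2 ≤ 1600 := Nat.pow_le_pow_left he₁ 2
    have h5 := Nat.mul_le_mul_right (B + 1) h4
    omega
  · by_cases h : k' = k
    · subst h
      by_cases h' : a = e₁.val s
      · subst h'; simpa [State.setArr] using hlt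
      · simpa [State.setArr, h'] using hs.2 k' a
    · simpa [State.setArr, h] using hs.2 k' a

theorem seq {c₁ c₂ : Cmd} (h : Runs B c₁ s T₁ fun s₁ => Runs B c₂ s₁ T₂ Q) :
    Runs B (.seq c₁ c₂) s (T₁ + T₂) Q := by
  intro hs
  obtain ⟨s₁, t₁, h1, h2, h3, h4⟩ := h hs
  obtain ⟨s₂, t₂, h5, h6, h7, h8⟩ := h4 h3
  exact ⟨s₂, _, Exec.seq h1 h5, by rw [add_mul]; omega, h7, h8⟩

theorem ite {e : Expr} {c₁ c₂ : Cmd} (h₁ : e.val s ≠ 0 → Runs B c₁ s T Q)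
    (h₂ : e.val s = 0 → Runs B c₂ s T Q) (he : e.weight ≤ 50 := by decide) :
    Runs B (.ite e c₁ c₂) s (T + 1) Q := by
  intro hs
  have := step_le hs e he
  by_cases h : e.val s = 0
  · obtain ⟨s', t, h1, h2, h3, h4⟩ := h₂ h hs
    exact ⟨s', _, Exec.iteFalse h h1, by rw [add_mul]; omega, h3, h4⟩
  · obtain ⟨s', t, h1, h2, h3, h4⟩ := h₁ h hs
    exact ⟨s', _, Exec.iteTrue h h1, by rw [add_mul]; omega, h3, h4⟩

/-- A loop with an invariant `I`, which is indexed by a bound for the number of iterations left. -/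
theorem loop {e : Expr} {c : Cmd} (I : ℕ → State → Prop) {k : ℕ} (h : I k s)
    (htrue : ∀ k s, I k s → e.val s ≠ 0 → ∃ k', k = k' + 1 ∧ Runs B c s T (I k'))
    (hfalse : ∀ k s, I k s → e.val s = 0 → Q s) (he : e.weight ≤ 50 := by decide) :
    Runs B (.loop e c) s (k * (T + 1) + 1) Q := by
  induction k generalizing s with
  | zero =>
    intro hs
    have h0 : e.val s = 0 := by
      by_contra hne
      obtain ⟨k', hk', -⟩ := htrue 0 s h hne
      omega
    have := step_le hs e he
    exact ⟨s, _, Exec.loopFalse h0, by omega, hs, hfalse 0 s h h0⟩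
  | succ k ih =>
    intro hs
    have hstep := step_le hs e he
    by_cases h0 : e.val s = 0
    · refine ⟨s, _, Exec.loopFalse h0, ?_, hs, hfalse _ s h h0⟩
      have : 0 ≤ (k + 1) * (T + 1) * (5000 * (B + 1)) := Nat.zero_le _
      linarith
    · obtain ⟨k', hk', hr⟩ := htrue _ s h h0
      obtain rfl : k' = k := by omega
      obtain ⟨s₁, t₁, h1, h2, h3, h4⟩ := hr hs
      obtain ⟨s₂, t₂, h5, h6, h7, h8⟩ := ih h4 h3
      refine ⟨s₂, _, Exec.loopTrue h0 h1 h5, ?_, h7, h8⟩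
      have : ((k' + 1) * (T + 1) + 1) * (5000 * (B + 1)) =
          5000 * (B + 1) + T * (5000 * (B + 1)) + (k' * (T + 1) + 1) * (5000 * (B + 1)) := by ring
      omega

end Runs

/-- The command `for r < e do c`. -/
def Cmd.forLoop (r : ℕ) (e : Expr) (c : Cmd) : Cmd :=
  .seq (.assign r (.const 0))
    (.loop (.sub e (.reg r)) (.seq c (.assign r (.add (.reg r) (.const 1)))))

theorem Runs.forLoop {B T n L : ℕ} {s : State} {Q : State → Prop} {r : ℕ} {e : Expr} {c : Cmd}
    (I : ℕ → State → Prop) (hn : n < 2 ^ B) (hL : n ≤ L) (h0 : I 0 (s.setReg r 0))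
    (he : ∀ k s, k ≤ n → I k s → s.reg r = k → e.val s = n)
    (hstep : ∀ k s, k < n → I k s → s.reg r = k →
      Runs B c s T fun s' => s'.reg r = k ∧ I (k + 1) (s'.setReg r (k + 1)))
    (hQ : ∀ s, I n s → Q s) (hw : e.weight ≤ 48 := by decide) :
    Runs B (.forLoop r e c) s (L * (T + 2) + 2) Q := by
  have hreg : ∀ (s : State) (x : ℕ), (s.setReg r x).reg r = x := fun s x => by simp [State.setReg]
  refine Runs.mono (T₁ := 1 + (n * (T + 1 + 1) + 1)) (Q := Q) ?_ ?_ fun _ h => h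
  · refine .seq (.assign (by simp [Expr.val]) ?_)
    refine .loop (fun k s => ∃ j, j + k = n ∧ I j s ∧ s.reg r = j)
      ⟨0, by omega, h0, hreg _ _⟩ ?_ ?_ (by simp only [Expr.weight]; omega)
    · rintro k s ⟨j, hjk, hI, hr⟩ hne
      have hv := he j s (by omega) hI hr
      simp only [Expr.val, hr, hv] at hne
      refine ⟨k - 1, by omega, .seq ((hstep j s (by omega) hI hr).mono le_rfl ?_)⟩
      rintro s' ⟨hr', hI'⟩
      refine .assign ?_ ?_ (by simp [Expr.weight])
      · simp only [Expr.val, hr']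
        omega
      · refine ⟨j + 1, by omega, ?_, ?_⟩
        · simpa [Expr.val, hr'] using hI'
        · simp [Expr.val, hr', hreg]
    · rintro k s ⟨j, hjk, hI, hr⟩ hz
      have hv := he j s (by omega) hI hr
      simp only [Expr.val, hr, hv] at hz
      obtain rfl : j = n := by omega
      exact hQ s hI
  · have := Nat.mul_le_mul_right (T + 2) hL
    have h2 : T + 1 + 1 = T + 2 := rfl
    rw [h2]
    omega

/-- Outside of the registers in `R` and the arrays in `K`, the two states agree. -/
def State.SameOutside (R K : List ℕ) (s s' : State) : Prop :=
  (∀ r, r ∉ R → s'.reg r = s.reg r) ∧ ∀ k, k ∉ K → s'.arr k = s.arr k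

theorem State.SameOutside.trans {R K : List ℕ} {s₁ s₂ s₃ : State} (h : s₁.SameOutside R K s₂)
    (h' : s₂.SameOutside R K s₃) : s₁.SameOutside R K s₃ :=
  ⟨fun r hr => (h'.1 r hr).trans (h.1 r hr), fun k hk => (h'.2 k hk).trans (h.2 k hk)⟩

theorem State.SameOutside.mono {R R' K K' : List ℕ} {s s' : State} (h : s.SameOutside R K s')
    (hR : R ⊆ R') (hK : K ⊆ K') : s.SameOutside R' K' s' :=
  ⟨fun r hr => h.1 r fun hr' => hr (hR hr'), fun k hk => h.2 k fun hk' => hk (hK hk')⟩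

theorem State.sameOutside_setReg {R K : List ℕ} {r : ℕ} (hr : r ∈ R) (s : State) (x : ℕ) :
    s.SameOutside R K (s.setReg r x) :=
  ⟨fun r' hr' => Function.update_of_ne (fun e => hr' (by rwa [e])) _ _, fun _ _ => rfl⟩

theorem State.sameOutside_setArr {R K : List ℕ} {k : ℕ} (hk : k ∈ K) (s : State) (a x : ℕ) :
    s.SameOutside R K (s.setArr k a x) :=
  ⟨fun _ _ => rfl, fun k' hk' => Function.update_of_ne (fun e => hk' (by rwa [e])) _ _⟩

@[simp] theorem State.reg_setReg (s : State) (r x r' : ℕ) :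
    (s.setReg r x).reg r' = if r' = r then x else s.reg r' := by
  simp [State.setReg, Function.update_apply]

@[simp] theorem State.arr_setReg (s : State) (r x : ℕ) : (s.setReg r x).arr = s.arr := rfl

@[simp] theorem State.reg_setArr (s : State) (k a x : ℕ) : (s.setArr k a x).reg = s.reg := rfl

@[simp] theorem State.arr_setArr (s : State) (k a x k' a' : ℕ) :
    (s.setArr k a x).arr k' a' = if k' = k ∧ a' = a then x else s.arr k' a' := by
  by_cases h : k' = k
  · subst h; simp [State.setArr, Function.update_apply]
  · simp [State.setArr, h]

/-- The remainder, expressed by the operations of the machine. -/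
def Expr.mod (e₁ e₂ : Expr) : Expr := .sub e₁ (.mul (.div e₁ e₂) e₂)

@[simp] theorem Expr.val_mod (s : State) (e₁ e₂ : Expr) :
    (Expr.mod e₁ e₂).val s = e₁.val s % e₂.val s := by
  simp only [mod, val]
  rw [Nat.mod_eq_sub_div_mul]

end RAM

namespace FairDivision

open RAM

/-! ### The candidates, on the machine -/

/-! Registers: `0` and `1` hold the numbers `n` of agents and `m` of goods, `2` the product of the
denominators, `4` the round, `5` the number of the candidate, `6` the result of the test, `7` the
part of this number that is still to be decoded; `8` and `9` count iterations. Arrays: `0` and `1`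
are the input, `2` is the candidate and in the end the output, `3` holds the weights, `4` the table
of owners found in the previous round, `5` the new names of the owners, `6` the values of the
bundles for one agent. The owner of an unallocated good is `n`. -/

/-- `m + 1`, where register `1` holds `m`. -/
def succGoods : Expr := .add (.reg 1) (.const 1)

/-- The change of table `2` that register `7` describes. -/
def changeCmd : Cmd :=
  .seq (.put 2 (.mod (.reg 7) succGoods) (.mod (.div (.reg 7) succGoods) (.reg 0)))
    (.assign 7 (.div (.div (.reg 7) succGoods) (.reg 0)))

/-- Store in array `5` the new names of the owners, read off from register `7`. -/
def digitCmd : Cmd :=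
  .seq (.put 5 (.reg 8) (.mod (.reg 7) (.reg 0))) (.assign 7 (.div (.reg 7) (.reg 0)))

/-- Write into array `2` the candidate, for the table in array `4`, whose number is in register
`5`. -/
def candidateCmd : Cmd :=
  .seq (.assign 7 (.reg 5)) <|
  .seq (.forLoop 8 (.reg 0) digitCmd) <|
  .seq (.put 5 (.reg 0) (.reg 0)) <|
  .seq (.forLoop 8 (.reg 1) (.put 2 (.reg 8) (.get 5 (.get 4 (.reg 8))))) <|
  .forLoop 8 (.const 27) changeCmd

theorem runs_candidateCmd {B L n m : ℕ} {s : State} (hn : 1 ≤ n) (hB : 5 ≤ B) (hnL : n ≤ L)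
    (hmL : m ≤ L) (h0 : s.reg 0 = n) (h1 : s.reg 1 = m) (hσ : ∀ u < m, s.arr 4 u ≤ n) :
    Runs B candidateCmd s (1 + ((L * (1 + 1 + 2) + 2) + (1 + ((L * (1 + 2) + 2) +
      (27 * (1 + 1 + 2) + 2))))) fun s' => s.SameOutside [7, 8] [2, 5] s' ∧
        ∀ u < m, s'.arr 2 u = candidate n m (s.arr 4) (s.reg 5) u := by
  refine .of_bounded fun hs => ?_
  have hnB : n < 2 ^ B := h0 ▸ hs.1 0
  have hmB : m < 2 ^ B := h1 ▸ hs.1 1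
  have hcB : s.reg 5 < 2 ^ B := hs.1 5
  have hreg : ∀ {s'}, s.SameOutside [7, 8] [2, 5] s' → s'.reg 0 = n ∧ s'.reg 1 = m ∧
      s'.arr 4 = s.arr 4 := fun h =>
    ⟨(h.1 0 (by decide)).trans h0, (h.1 1 (by decide)).trans h1, h.2 4 (by decide)⟩
  refine .seq (.assign (by simpa [Expr.val]) (.seq (.forLoop (n := n) (fun k s' =>
    s.SameOutside [7, 8] [2, 5] s' ∧ s'.reg 7 = s.reg 5 / n ^ k ∧
      ∀ i < k, s'.arr 5 i = s.reg 5 / n ^ i % n) hnB hnL ?_ ?_ ?_ ?_)))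
  · refine ⟨((State.sameOutside_setReg (by decide) _ _).trans
      (State.sameOutside_setReg (by decide) _ _)), by simp [Expr.val], by simp⟩
  · rintro k s' - ⟨hf, -⟩ -
    exact (hreg hf).1
  · rintro k s' hk ⟨hf, h7, h5⟩ h8
    obtain ⟨hr0, -, -⟩ := hreg hf
    refine .seq (.put ?_ (.assign ?_ ⟨?_, ?_, ?_, ?_⟩))
    · simp only [Expr.val_mod, Expr.val, hr0]
      exact (Nat.mod_lt _ hn).trans hnB
    · simp only [Expr.val, State.reg_setArr, h7]
      exact (Nat.div_le_self _ _).trans_lt ((Nat.div_le_self _ _).trans_lt hcB)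
    · simpa using h8
    · exact hf.trans ((State.sameOutside_setArr (by decide) _ _ _).trans
        ((State.sameOutside_setReg (by decide) _ _).trans
          (State.sameOutside_setReg (by decide) _ _)))
    · simp [Expr.val, h7, hr0, pow_succ, Nat.div_div_eq_div_mul]
    · intro i hi
      by_cases hik : i = k
      · simp [Expr.val, hik, h7, hr0, h8]
      · simpa [Expr.val, hik, h8] using h5 i (by omega)
  rintro s₁ ⟨hf₁, h7₁, h5₁⟩
  obtain ⟨hr0, hr1, hr4⟩ := hreg hf₁
  refine .seq (.put (by simpa [Expr.val, hr0]) (.seq (.forLoop (n := m) (fun k s' =>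
    s.SameOutside [7, 8] [2, 5] s' ∧ s'.reg 7 = s.reg 5 / n ^ n ∧
      (∀ i < n, s'.arr 5 i = s.reg 5 / n ^ i % n) ∧ s'.arr 5 n = n ∧
      ∀ u < k, s'.arr 2 u = if s.arr 4 u < n then s.reg 5 / n ^ s.arr 4 u % n else n)
    hmB hmL ?_ ?_ ?_ ?_)))
  · refine ⟨hf₁.trans ((State.sameOutside_setArr (by decide) _ _ _).trans
      (State.sameOutside_setReg (by decide) _ _)), by simpa using h7₁, fun i hi => ?_, ?_, by simp⟩
    · simpa [Expr.val, hr0, hi.ne] using h5₁ i hi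
    · simp [Expr.val, hr0]
  · rintro k s' - ⟨hf, -⟩ -
    exact (hreg hf).2.1
  · rintro k s' hk ⟨hf, h7, h5, h5n, h2⟩ h8
    refine .of_bounded fun hs' => ?_
    refine .put (hs'.2 _ _) ⟨by simpa using h8, ?_, by simpa using h7, by simpa using h5,
      by simpa using h5n, fun u hu => ?_⟩
    · exact hf.trans ((State.sameOutside_setArr (by decide) _ _ _).trans
        (State.sameOutside_setReg (by decide) _ _))
    · by_cases huk : u = k
      · have hle := hσ k hk
        simp only [Expr.val, huk, h8, (hreg hf).2.2, State.arr_setReg, State.arr_setArr, and_self,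
          if_true]
        by_cases hlt : s.arr 4 k < n
        · rw [if_pos hlt, h5 _ hlt]
        · rw [if_neg hlt, show s.arr 4 k = n by omega, h5n]
      · simpa [Expr.val, huk, h8] using h2 u (by omega)
  rintro s₂ ⟨hf₂, h7₂, -, -, h2₂⟩
  refine .forLoop (n := 27) (fun k s' => s.SameOutside [7, 8] [2, 5] s' ∧
    ∀ u < m, applyChanges n m (27 - k) (s'.reg 7) (s'.arr 2) u =
      candidate n m (s.arr 4) (s.reg 5) u)
    ((show 27 < 2 ^ 5 by norm_num).trans_le (Nat.pow_le_pow_right (by norm_num) hB)) le_rfl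
    ?_ ?_ ?_ ?_
  · refine ⟨hf₂.trans (State.sameOutside_setReg (by decide) _ _), fun u hu => ?_⟩
    simp only [State.reg_setReg, State.arr_setReg, h7₂]
    exact applyChanges_congr 27 _ h2₂ u hu
  · intros
    rfl
  · rintro k s' hk ⟨hf, h2⟩ h8
    obtain ⟨hr0, hr1, -⟩ := hreg hf
    refine .of_bounded fun hs' => .seq (.put ?_ (.assign ?_ ⟨?_, ?_, ?_⟩))
    · simp only [Expr.val_mod, Expr.val, hr0]
      exact (Nat.mod_lt _ hn).trans hnB
    · simp only [Expr.val, State.reg_setArr]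
      exact (Nat.div_le_self _ _).trans_lt ((Nat.div_le_self _ _).trans_lt (hs'.1 7))
    · simpa using h8
    · exact hf.trans ((State.sameOutside_setArr (by decide) _ _ _).trans
        ((State.sameOutside_setReg (by decide) _ _).trans
          (State.sameOutside_setReg (by decide) _ _)))
    · intro u hu
      rw [← h2 u hu, show 27 - k = (27 - (k + 1)) + 1 by omega, applyChanges]
      simp [Expr.val, succGoods, hr0, hr1, State.setArr]
  · rintro s' ⟨hf, h2⟩
    exact ⟨hf, h2⟩

/-! ### The test, on the machine -/

/-- The weight of good `u` for agent `i`, if registers `8` and `9` hold `u` and `i`. -/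
def weightExpr : Expr := .get 3 (.add (.mul (.reg 9) (.reg 1)) (.reg 8))

/-- The sum, stored in array `6`, over the bundle that contains the good in register `8`. -/
def ownerSumExpr : Expr := .get 6 (.get 2 (.reg 8))

/-- The sum over the bundle of the agent in register `9`. -/
def agentSumExpr : Expr := .get 6 (.reg 9)

/-- Multiply register `6` by `0` if `e` is positive. -/
def failIfPos (e : Expr) : Cmd := .assign 6 (.mul (.reg 6) (.sub (.const 1) e))

/-- The conditions of the test for the agent in register `9` and the good in register `8`. -/
def checkCmd : Cmd :=
  .ite (.sub (.reg 0) (.get 2 (.reg 8)))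
    (failIfPos (.sub (.mul (.const 2) ownerSumExpr)
      (.add (.mul (.const 3) agentSumExpr) (.mul (.const 2) weightExpr))))
    (failIfPos (.add (.sub (.reg 4) (.reg 8)) (.sub (.mul (.const 2) weightExpr) agentSumExpr)))

/-- The test for the agent in register `9`. -/
def testAgentCmd : Cmd :=
  .seq (.forLoop 8 (.add (.reg 0) (.const 1)) (.put 6 (.reg 8) (.const 0))) <|
  .seq (.forLoop 8 (.reg 1) (.put 6 (.get 2 (.reg 8)) (.add ownerSumExpr weightExpr))) <|
  .forLoop 8 (.reg 1) checkCmd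

/-- Set register `6` to `1` if the table in array `2` passes the test, and to `0` otherwise. -/
def testCmd : Cmd :=
  .seq (.assign 6 (.const 1)) (.forLoop 9 (.reg 0) testAgentCmd)

theorem runs_failIfPos {B : ℕ} {s : State} {e : Expr} {Q : State → Prop} (h6 : s.reg 6 ≤ 1)
    (hB : 1 ≤ B) (hQ : ∀ x, (x = s.reg 6 ∧ e.val s = 0 ∨ x = 0 ∧ e.val s ≠ 0) → Q (s.setReg 6 x))
    (he : e.weight ≤ 45 := by decide) : Runs B (failIfPos e) s 1 Q := by
  have hval : (Expr.mul (.reg 6) (.sub (.const 1) e)).val s = s.reg 6 * (1 - e.val s) := rfl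
  refine .assign ?_ (hQ _ ?_) (by simp only [Expr.weight]; omega)
  · rw [hval]
    calc s.reg 6 * (1 - e.val s) ≤ 1 * 1 := Nat.mul_le_mul h6 (by omega)
      _ < 2 ^ B := Nat.one_lt_two_pow (by omega)
  · rw [hval]
    by_cases h : e.val s = 0
    · exact Or.inl ⟨by simp [h], h⟩
    · exact Or.inr ⟨by rw [show 1 - e.val s = 0 by omega, Nat.mul_zero], h⟩

theorem runs_testAgentCmd {B L n m i : ℕ} {s : State} (hi : i < n) (hB : 1 ≤ B) (hnL : n + 1 ≤ L)
    (hmL : m ≤ L) (hnB : n + 1 < 2 ^ B) (h0 : s.reg 0 = n) (h1 : s.reg 1 = m) (h9 : s.reg 9 = i)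
    (h6 : s.reg 6 ≤ 1) (hσ : ∀ u < m, s.arr 2 u ≤ n)
    (hw : ∑ u ∈ Finset.range m, s.arr 3 (i * m + u) < 2 ^ B) :
    Runs B testAgentCmd s ((L * (1 + 2) + 2) + ((L * (1 + 2) + 2) +
      (L * (1 + 1 + 2) + 2))) fun s' =>
        s.SameOutside [6, 8] [6] s' ∧ s'.reg 6 ≤ 1 ∧ (s'.reg 6 = 1 ↔ s.reg 6 = 1 ∧
        ∀ u < m, IsGoodAt n m (s.arr 3) (s.reg 4) (s.arr 2) i u) := by
  refine .of_bounded fun hs => ?_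
  have hmB : m < 2 ^ B := h1 ▸ hs.1 1
  have hreg : ∀ {s'}, s.SameOutside [6, 8] [6] s' → s'.reg 0 = n ∧ s'.reg 1 = m ∧
      s'.reg 9 = i ∧ s'.reg 4 = s.reg 4 ∧ s'.arr 2 = s.arr 2 ∧ s'.arr 3 = s.arr 3 := fun h =>
    ⟨(h.1 0 (by decide)).trans h0, (h.1 1 (by decide)).trans h1, (h.1 9 (by decide)).trans h9,
      h.1 4 (by decide), h.2 2 (by decide), h.2 3 (by decide)⟩
  refine .seq (.forLoop (n := n + 1) (fun k s' => s.SameOutside [6, 8] [6] s' ∧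
    s'.reg 6 = s.reg 6 ∧ ∀ j < k, s'.arr 6 j = 0) hnB hnL ?_ ?_ ?_ ?_)
  · exact ⟨State.sameOutside_setReg (by decide) _ _, by simp, by simp⟩
  · rintro k s' - ⟨hf, -⟩ -
    simp [Expr.val, (hreg hf).1]
  · rintro k s' hk ⟨hf, hr6, h⟩ h8
    refine .put (by simp [Expr.val]) ⟨by simpa using h8, ?_, by simpa using hr6, fun j hj => ?_⟩
    · exact hf.trans ((State.sameOutside_setArr (by decide) _ _ _).trans
        (State.sameOutside_setReg (by decide) _ _))
    · by_cases hjk : j = k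
      · simp [Expr.val, hjk, h8]
      · simpa [Expr.val, hjk, h8] using h j (by omega)
  rintro s₁ ⟨hf₁, hr6₁, hz₁⟩
  refine .seq (.forLoop (n := m) (fun k s' => s.SameOutside [6, 8] [6] s' ∧
    s'.reg 6 = s.reg 6 ∧ ∀ j ≤ n, s'.arr 6 j =
      ∑ u ∈ Finset.range k, if s.arr 2 u = j then s.arr 3 (i * m + u) else 0) hmB hmL ?_ ?_ ?_ ?_)
  · exact ⟨hf₁.trans (State.sameOutside_setReg (by decide) _ _), by simpa using hr6₁,
      fun j hj => by simpa using hz₁ j (by omega)⟩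
  · rintro k s' - ⟨hf, -⟩ -
    exact (hreg hf).2.1
  · rintro k s' hk ⟨hf, hr6, h⟩ h8
    obtain ⟨-, hr1, hr9, -, hr2, hr3⟩ := hreg hf
    have hval : (Expr.add ownerSumExpr weightExpr).val s' =
        ∑ u ∈ Finset.range (k + 1), if s.arr 2 u = s.arr 2 k then s.arr 3 (i * m + u) else 0 := by
      simp only [Expr.val, ownerSumExpr, weightExpr, hr1, hr9, hr2, hr3, h8]
      rw [h _ (hσ k hk), Finset.sum_range_succ, if_pos rfl]
    refine .put ?_ ⟨by simpa using h8, ?_, by simpa using hr6, fun j hj => ?_⟩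
    · rw [hval]
      refine lt_of_le_of_lt ?_ hw
      refine (Finset.sum_le_sum fun u _ => ?_).trans
        (Finset.sum_le_sum_of_subset (Finset.range_subset_range.2 hk))
      split_ifs
      · exact le_rfl
      · exact Nat.zero_le _
    · exact hf.trans ((State.sameOutside_setArr (by decide) _ _ _).trans
        (State.sameOutside_setReg (by decide) _ _))
    · rw [hval]
      simp only [State.arr_setReg, State.arr_setArr, Expr.val, hr2, h8, true_and]
      by_cases hjk : j = s.arr 2 k
      · rw [if_pos hjk, hjk]
      · rw [if_neg hjk, Finset.sum_range_succ, if_neg (Ne.symm hjk), Nat.add_zero, h j hj]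
  rintro s₂ ⟨hf₂, hr6₂, hz₂⟩
  have hz₂' : ∀ j ≤ n, s₂.arr 6 j = ownedWeight m (s.arr 3) (s.arr 2) i j := hz₂
  refine .forLoop (n := m) (fun k s' => s.SameOutside [6, 8] [6] s' ∧ s'.arr 6 = s₂.arr 6 ∧
    s'.reg 6 ≤ 1 ∧ (s'.reg 6 = 1 ↔ s.reg 6 = 1 ∧
      ∀ u < k, IsGoodAt n m (s.arr 3) (s.reg 4) (s.arr 2) i u)) hmB hmL ?_ ?_ ?_ ?_
  · exact ⟨hf₂.trans (State.sameOutside_setReg (by decide) _ _), by simp, by simpa [hr6₂] using h6,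
      by simp [hr6₂]⟩
  · rintro k s' - ⟨hf, -⟩ -
    exact (hreg hf).2.1
  · rintro k s' hk ⟨hf, ha6, hle, hiff⟩ h8
    obtain ⟨hr0, hr1, hr9, hr4, hr2, hr3⟩ := hreg hf
    -- the state after the conditions have been checked
    have hdone : ∀ x, (x = s'.reg 6 ∧ IsGoodAt n m (s.arr 3) (s.reg 4) (s.arr 2) i k ∨
        x = 0 ∧ ¬ IsGoodAt n m (s.arr 3) (s.reg 4) (s.arr 2) i k) →
        (s'.setReg 6 x).reg 8 = k ∧ s.SameOutside [6, 8] [6] ((s'.setReg 6 x).setReg 8 (k + 1)) ∧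
        ((s'.setReg 6 x).setReg 8 (k + 1)).arr 6 = s₂.arr 6 ∧
        ((s'.setReg 6 x).setReg 8 (k + 1)).reg 6 ≤ 1 ∧
        (((s'.setReg 6 x).setReg 8 (k + 1)).reg 6 = 1 ↔ s.reg 6 = 1 ∧
          ∀ u < k + 1, IsGoodAt n m (s.arr 3) (s.reg 4) (s.arr 2) i u) := by
      intro x hx
      refine ⟨by simpa using h8, hf.trans ((State.sameOutside_setReg (by decide) _ _).trans
        (State.sameOutside_setReg (by decide) _ _)), by simpa using ha6, ?_, ?_⟩
      · simp only [State.reg_setReg, show (6 : ℕ) ≠ 8 by decide, if_true, if_false]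
        omega
      · simp only [State.reg_setReg, show (6 : ℕ) ≠ 8 by decide, if_true, if_false]
        rcases hx with ⟨rfl, hx⟩ | ⟨rfl, hx⟩
        · rw [hiff, Nat.forall_lt_succ_right]
          tauto
        · refine ⟨fun h => absurd h (by decide), fun h => absurd (h.2 k k.lt_succ_self) hx⟩
    have hsub : (Expr.sub (.reg 0) (.get 2 (.reg 8))).val s' = n - s.arr 2 k := by
      simp [Expr.val, hr0, hr2, h8]
    have hagent : agentSumExpr.val s' = ownedWeight m (s.arr 3) (s.arr 2) i i := by
      simp only [agentSumExpr, Expr.val, hr9, ha6]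
      exact hz₂' i hi.le
    have howner : ownerSumExpr.val s' = ownedWeight m (s.arr 3) (s.arr 2) i (s.arr 2 k) := by
      simp only [ownerSumExpr, Expr.val, h8, hr2, ha6]
      exact hz₂' _ (hσ k hk)
    have hweight : weightExpr.val s' = s.arr 3 (i * m + k) := by
      simp [weightExpr, Expr.val, h8, hr1, hr9, hr3]
    refine .ite (fun hne => ?_) fun he => ?_
    · rw [hsub] at hne
      refine runs_failIfPos hle hB fun x hx => hdone x ?_
      simp only [Expr.val, hagent, howner, hweight] at hx
      unfold IsGoodAt
      omega
    · rw [hsub] at he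
      refine runs_failIfPos hle hB fun x hx => hdone x ?_
      simp only [Expr.val, hagent, hweight, hr4, h8] at hx
      unfold IsGoodAt
      omega
  · rintro s' ⟨hf, -, hle, hiff⟩
    exact ⟨hf, hle, hiff⟩

theorem runs_testCmd {B L n m : ℕ} {s : State} (hB : 1 ≤ B) (hnL : n + 1 ≤ L)
    (hmL : m ≤ L) (hnB : n + 1 < 2 ^ B) (h0 : s.reg 0 = n) (h1 : s.reg 1 = m)
    (hσ : ∀ u < m, s.arr 2 u ≤ n)
    (hw : ∀ i < n, ∑ u ∈ Finset.range m, s.arr 3 (i * m + u) < 2 ^ B) :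
    Runs B testCmd s (1 + (L * (((L * (1 + 2) + 2) + ((L * (1 + 2) + 2) +
      (L * (1 + 1 + 2) + 2))) + 2) + 2)) fun s' => s.SameOutside [6, 8, 9] [6] s' ∧
        s'.reg 6 ≤ 1 ∧ (s'.reg 6 = 1 ↔ IsGood n m (s.arr 3) (s.reg 4) (s.arr 2)) := by
  refine .seq (.assign (by simpa [Expr.val] using by omega) ?_)
  refine .forLoop (n := n) (fun k s' => s.SameOutside [6, 8, 9] [6] s' ∧ s'.reg 6 ≤ 1 ∧
    (s'.reg 6 = 1 ↔ ∀ i < k, ∀ u < m, IsGoodAt n m (s.arr 3) (s.reg 4) (s.arr 2) i u))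
    (by omega) (by omega) ?_ ?_ ?_ ?_
  · exact ⟨(State.sameOutside_setReg (by decide) _ _).trans
      (State.sameOutside_setReg (by decide) _ _), by simp [Expr.val], by simp [Expr.val]⟩
  · rintro k s' - ⟨hf, -⟩ -
    exact (hf.1 0 (by decide)).trans h0
  · rintro k s' hk ⟨hf, hle, hiff⟩ h9
    have hr2 := hf.2 2 (by decide)
    have hr3 := hf.2 3 (by decide)
    have hr4 := hf.1 4 (by decide)
    refine (runs_testAgentCmd hk hB hnL hmL hnB ((hf.1 0 (by decide)).trans h0)
      ((hf.1 1 (by decide)).trans h1) h9 hle (by rwa [hr2]) (by rw [hr3]; exact hw k hk)).mono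
      le_rfl ?_
    rintro s'' ⟨hf', hle', hiff'⟩
    refine ⟨(hf'.1 9 (by decide)).trans h9, (hf.trans (hf'.mono (by decide) (by decide))).trans
      (State.sameOutside_setReg (by decide) _ _), by simpa using hle', ?_⟩
    simp only [State.reg_setReg, show (6 : ℕ) ≠ 9 by decide, if_false]
    rw [hiff', hiff, hr2, hr3, hr4, Nat.forall_lt_succ_right]
  · rintro s' ⟨hf, hle, hiff⟩
    exact ⟨hf, hle, hiff⟩

/-! ### The search and the rounds -/

/-- Find the first candidate, for the table in array `4`, that passes the test. -/
def searchCmd : Cmd :=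
  .seq (.assign 5 (.const 0)) <|
  .seq (.assign 6 (.const 0)) <|
  .loop (.sub (.const 1) (.reg 6))
    (.seq candidateCmd (.seq testCmd (.assign 5 (.add (.reg 5) (.const 1)))))

/-- One round: search, and save the table that has been found in array `4`. -/
def roundCmd : Cmd :=
  .seq searchCmd (.forLoop 8 (.reg 1) (.put 4 (.reg 8) (.get 2 (.reg 8))))

/-- A bound for the number of steps to produce and test one candidate, if there are fewer than `L`
agents and at most `L` goods. -/
def candidateTime (L : ℕ) : ℕ :=
  (1 + ((L * (1 + 1 + 2) + 2) + (1 + ((L * (1 + 2) + 2) + (27 * (1 + 1 + 2) + 2))))) +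
    ((1 + (L * (((L * (1 + 2) + 2) + ((L * (1 + 2) + 2) + (L * (1 + 1 + 2) + 2))) + 2) + 2)) + 1)

theorem runs_searchCmd {B L K n m c₀ : ℕ} {s : State} (hn : 1 ≤ n) (hB : 5 ≤ B) (hnL : n + 1 ≤ L)
    (hmL : m ≤ L) (hnB : n + 1 < 2 ^ B) (hKB : K < 2 ^ B) (h0 : s.reg 0 = n) (h1 : s.reg 1 = m)
    (hσ : ∀ u < m, s.arr 4 u ≤ n)
    (hw : ∀ i < n, ∑ u ∈ Finset.range m, s.arr 3 (i * m + u) < 2 ^ B) (hc₀ : c₀ < K)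
    (hgood : IsGood n m (s.arr 3) (s.reg 4) (candidate n m (s.arr 4) c₀)) :
    Runs B searchCmd s (1 + (1 + (K * (candidateTime L + 1) + 1))) fun s' =>
      s.SameOutside [5, 6, 7, 8, 9] [2, 5, 6] s' ∧ (∀ u < m, s'.arr 2 u ≤ n) ∧
        IsGood n m (s.arr 3) (s.reg 4) (s'.arr 2) := by
  refine .seq (.assign (by simp [Expr.val]) (.seq (.assign (by simp [Expr.val]) ?_)))
  refine Runs.mono (T₁ := (c₀ + 1) * (candidateTime L + 1) + 1) ?_
    (Nat.add_le_add_right (Nat.mul_le_mul_right _ hc₀) 1) fun _ h => h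
  -- the number of the next candidate is `c₀ + 1 - k`, unless one has been found
  refine .loop (fun k s' => s.SameOutside [5, 6, 7, 8, 9] [2, 5, 6] s' ∧
    (s'.reg 6 = 1 ∧ (∀ u < m, s'.arr 2 u ≤ n) ∧ IsGood n m (s.arr 3) (s.reg 4) (s'.arr 2) ∨
      s'.reg 6 = 0 ∧ 1 ≤ k ∧ s'.reg 5 + k = c₀ + 1)) ?_ ?_ ?_
  · exact ⟨(State.sameOutside_setReg (by decide) _ _).trans
      (State.sameOutside_setReg (by decide) _ _), Or.inr (by simp [Expr.val])⟩
  · rintro k s₁ ⟨hf, h⟩ hne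
    have h6 : s₁.reg 6 ≠ 1 := fun e => hne (by simp [Expr.val, e])
    obtain ⟨-, hk, h5⟩ := h.resolve_left fun h' => h6 h'.1
    refine ⟨k - 1, by omega, .seq ?_⟩
    have hr0 : s₁.reg 0 = n := (hf.1 0 (by decide)).trans h0
    have hr1 : s₁.reg 1 = m := (hf.1 1 (by decide)).trans h1
    have hr4 := hf.2 4 (by decide)
    refine (runs_candidateCmd hn hB (by omega) hmL hr0 hr1 (by rwa [hr4])).mono le_rfl ?_
    rintro s₂ ⟨hf₂, hcand⟩
    have hf₂' := hf.trans (hf₂.mono (by decide) (by decide))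
    have hle : ∀ u < m, s₂.arr 2 u ≤ n := fun u hu => by
      rw [hcand u hu]
      exact candidate_le hn _ _ _
    have ha3 := hf₂'.2 3 (by decide)
    refine .seq ((runs_testCmd (by omega) hnL hmL hnB ((hf₂'.1 0 (by decide)).trans h0)
      ((hf₂'.1 1 (by decide)).trans h1) hle (by rwa [ha3])).mono le_rfl ?_)
    rintro s₃ ⟨hf₃, h6₃, hiff⟩
    have hf₃' := hf₂'.trans (hf₃.mono (by decide) (by decide))
    have h5₃ : s₃.reg 5 = s₁.reg 5 := (hf₃.1 5 (by decide)).trans (hf₂.1 5 (by decide))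
    have ha2 := hf₃.2 2 (by decide)
    rw [ha3, hf₂'.1 4 (by decide)] at hiff
    refine .assign (by simp only [Expr.val]; omega)
      ⟨hf₃'.trans (State.sameOutside_setReg (by decide) _ _), ?_⟩
    simp only [State.reg_setReg, State.arr_setReg, show (6 : ℕ) ≠ 5 by decide, if_true, if_false]
    by_cases h61 : s₃.reg 6 = 1
    · exact Or.inl ⟨h61, by rwa [ha2], by rw [ha2]; exact hiff.1 h61⟩
    · refine Or.inr ⟨by omega, ?_⟩
      have hne₀ : s₁.reg 5 ≠ c₀ := by
        intro e
        refine h61 (hiff.2 (hgood.congr fun u hu => ?_))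
        rw [hcand u hu, e, hr4]
      simp only [Expr.val]
      omega
  · rintro k s' ⟨hf, h⟩ he
    have h6 : s'.reg 6 ≠ 0 := fun e => by simp [Expr.val, e] at he
    obtain ⟨-, h2, h3⟩ := h.resolve_right fun h' => h6 h'.1
    exact ⟨hf, h2, h3⟩

/-- A bound for the number of steps of a round. -/
def roundTime (L K : ℕ) : ℕ := (1 + (1 + (K * (candidateTime L + 1) + 1))) + (L * (1 + 2) + 2)

theorem runs_roundCmd {B L K n m c₀ : ℕ} {s : State} (hn : 1 ≤ n) (hB : 5 ≤ B) (hnL : n + 1 ≤ L)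
    (hmL : m ≤ L) (hnB : n + 1 < 2 ^ B) (hKB : K < 2 ^ B) (h0 : s.reg 0 = n) (h1 : s.reg 1 = m)
    (hσ : ∀ u < m, s.arr 4 u ≤ n)
    (hw : ∀ i < n, ∑ u ∈ Finset.range m, s.arr 3 (i * m + u) < 2 ^ B) (hc₀ : c₀ < K)
    (hgood : IsGood n m (s.arr 3) (s.reg 4) (candidate n m (s.arr 4) c₀)) :
    Runs B roundCmd s (roundTime L K) fun s' =>
      s.SameOutside [5, 6, 7, 8, 9] [2, 4, 5, 6] s' ∧ (∀ u < m, s'.arr 2 u ≤ n) ∧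
        (∀ u < m, s'.arr 4 u = s'.arr 2 u) ∧ IsGood n m (s.arr 3) (s.reg 4) (s'.arr 2) := by
  refine .seq ((runs_searchCmd hn hB hnL hmL hnB hKB h0 h1 hσ hw hc₀ hgood).mono le_rfl ?_)
  rintro s₁ ⟨hf₁, hle, hg⟩
  refine .of_bounded fun hs₁ => ?_
  have hr1 : s₁.reg 1 = m := (hf₁.1 1 (by decide)).trans h1
  refine .forLoop (n := m) (fun k s' => s₁.SameOutside [8] [4] s' ∧
    ∀ u < k, s'.arr 4 u = s₁.arr 2 u) (hr1 ▸ hs₁.1 1) hmL ?_ ?_ ?_ ?_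
  · exact ⟨State.sameOutside_setReg (by decide) _ _, by simp⟩
  · rintro k s' - ⟨hf, -⟩ -
    exact (hf.1 1 (by decide)).trans hr1
  · rintro k s' hk ⟨hf, h⟩ h8
    have ha2 := hf.2 2 (by decide)
    refine .put ?_ ⟨by simpa using h8, hf.trans ((State.sameOutside_setArr (by decide) _ _ _).trans
      (State.sameOutside_setReg (by decide) _ _)), fun u hu => ?_⟩
    · simp only [Expr.val, ha2]
      exact hs₁.2 2 _
    · by_cases huk : u = k
      · simp [Expr.val, huk, h8, ha2]
      · simpa [Expr.val, huk, h8] using h u (by omega)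
  · rintro s' ⟨hf, h⟩
    have ha2 := hf.2 2 (by decide)
    exact ⟨(hf₁.mono (by decide) (by decide)).trans (hf.mono (by decide) (by decide)),
      by rwa [ha2], by rwa [ha2], by rwa [ha2]⟩

/-! ### The program -/

/-- `n * m`, where registers `0` and `1` hold `n` and `m`. -/
def entriesExpr : Expr := .mul (.reg 0) (.reg 1)

/-- Compute the product of all denominators in register `2`, store in array `3` the values
multiplied by this product, and mark all goods as unallocated in array `4`. -/
def prepareCmd : Cmd :=
  .seq (.assign 2 (.const 1)) <|
  .seq (.forLoop 8 entriesExpr (.assign 2 (.mul (.reg 2) (.get 1 (.reg 8))))) <|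
  .seq (.forLoop 8 entriesExpr (.put 3 (.reg 8)
    (.mul (.get 0 (.reg 8)) (.div (.reg 2) (.get 1 (.reg 8)))))) <|
  .forLoop 8 (.reg 1) (.put 4 (.reg 8) (.reg 0))

theorem runs_prepareCmd {B L n m D : ℕ} {s : State} (hB : 1 ≤ B) (hmL : n * m ≤ L) (hm : m ≤ L)
    (hnm : n * m < 2 ^ B) (h0 : s.reg 0 = n) (h1 : s.reg 1 = m)
    (hpos : ∀ a < n * m, 1 ≤ s.arr 1 a) (hD : D = ∏ a ∈ Finset.range (n * m), s.arr 1 a)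
    (hDB : D < 2 ^ B) (hwB : ∀ a < n * m, s.arr 0 a * (D / s.arr 1 a) < 2 ^ B) :
    Runs B prepareCmd s (1 + ((L * (1 + 2) + 2) + ((L * (1 + 2) + 2) + (L * (1 + 2) + 2))))
      fun s' => s.SameOutside [2, 8] [3, 4] s' ∧
        (∀ a < n * m, s'.arr 3 a = s.arr 0 a * (D / s.arr 1 a)) ∧ ∀ u < m, s'.arr 4 u = n := by
  refine .of_bounded fun hs => ?_
  have hreg : ∀ {s'}, s.SameOutside [2, 8] [3, 4] s' → s'.reg 0 = n ∧ s'.reg 1 = m ∧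
      s'.arr 0 = s.arr 0 ∧ s'.arr 1 = s.arr 1 := fun h =>
    ⟨(h.1 0 (by decide)).trans h0, (h.1 1 (by decide)).trans h1, h.2 0 (by decide),
      h.2 1 (by decide)⟩
  have hentries : ∀ {s'}, s.SameOutside [2, 8] [3, 4] s' → entriesExpr.val s' = n * m :=
    fun h => by simp [entriesExpr, Expr.val, hreg h]
  refine .seq (.assign (by simpa [Expr.val] using by omega) (.seq (.forLoop (n := n * m)
    (fun k s' => s.SameOutside [2, 8] [3, 4] s' ∧ s'.reg 2 = ∏ a ∈ Finset.range k, s.arr 1 a)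
    hnm hmL ?_ ?_ ?_ ?_)))
  · exact ⟨(State.sameOutside_setReg (by decide) _ _).trans
      (State.sameOutside_setReg (by decide) _ _), by simp [Expr.val]⟩
  · rintro k s' - ⟨hf, -⟩ -
    exact hentries hf
  · rintro k s' hk ⟨hf, h2⟩ h8
    have hval : (Expr.mul (.reg 2) (.get 1 (.reg 8))).val s' =
        ∏ a ∈ Finset.range (k + 1), s.arr 1 a := by
      simp [Expr.val, h2, h8, hreg hf, Finset.prod_range_succ]
    refine .assign ?_ ⟨by simpa using h8, hf.trans ((State.sameOutside_setReg (by decide) _ _).trans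
      (State.sameOutside_setReg (by decide) _ _)), by simpa using hval⟩
    rw [hval]
    refine lt_of_le_of_lt ?_ hDB
    rw [hD]
    exact Finset.prod_le_prod_of_subset_of_one_le' (Finset.range_subset_range.2 hk)
      fun a ha _ => hpos a (Finset.mem_range.1 ha)
  rintro s₁ ⟨hf₁, h2₁⟩
  rw [← hD] at h2₁
  refine .seq (.forLoop (n := n * m) (fun k s' => s.SameOutside [2, 8] [3, 4] s' ∧
    s'.reg 2 = D ∧ ∀ a < k, s'.arr 3 a = s.arr 0 a * (D / s.arr 1 a)) hnm hmL ?_ ?_ ?_ ?_)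
  · exact ⟨hf₁.trans (State.sameOutside_setReg (by decide) _ _), by simpa using h2₁, by simp⟩
  · rintro k s' - ⟨hf, -⟩ -
    exact hentries hf
  · rintro k s' hk ⟨hf, h2, h3⟩ h8
    have hval : (Expr.mul (.get 0 (.reg 8)) (.div (.reg 2) (.get 1 (.reg 8)))).val s' =
        s.arr 0 k * (D / s.arr 1 k) := by
      simp [Expr.val, h2, h8, hreg hf]
    refine .put (by rw [hval]; exact hwB k hk) ⟨by simpa using h8,
      hf.trans ((State.sameOutside_setArr (by decide) _ _ _).trans
      (State.sameOutside_setReg (by decide) _ _)), by simpa using h2, fun a ha => ?_⟩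
    rw [hval]
    by_cases hak : a = k
    · simp [Expr.val, hak, h8]
    · simpa [Expr.val, hak, h8] using h3 a (by omega)
  rintro s₂ ⟨hf₂, -, h3₂⟩
  refine .forLoop (n := m) (fun k s' => s.SameOutside [2, 8] [3, 4] s' ∧
    (∀ a < n * m, s'.arr 3 a = s.arr 0 a * (D / s.arr 1 a)) ∧ ∀ u < k, s'.arr 4 u = n)
    (h1 ▸ hs.1 1) hm ?_ ?_ ?_ ?_
  · exact ⟨hf₂.trans (State.sameOutside_setReg (by decide) _ _), by simpa using h3₂, by simp⟩
  · rintro k s' - ⟨hf, -⟩ -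
    exact (hreg hf).2.1
  · rintro k s' hk ⟨hf, h3, h4⟩ h8
    refine .put ?_ ⟨by simpa using h8, hf.trans ((State.sameOutside_setArr (by decide) _ _ _).trans
      (State.sameOutside_setReg (by decide) _ _)), by simpa using h3, fun u hu => ?_⟩
    · simp only [Expr.val, (hreg hf).1]
      exact h0 ▸ hs.1 0
    · by_cases huk : u = k
      · simp [Expr.val, huk, h8, hreg hf]
      · simpa [Expr.val, huk, h8] using h4 u (by omega)
  · rintro s' h
    exact h

/-- After the preparation there is one round for the seed and one round for each good. -/
def efxCmd : Cmd := .seq prepareCmd (.forLoop 4 succGoods roundCmd)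

/-- A bound for the number of steps of the whole program. -/
def efxTime (L K : ℕ) : ℕ :=
  (1 + ((L * (1 + 2) + 2) + ((L * (1 + 2) + 2) + (L * (1 + 2) + 2)))) +
    (L * (roundTime L K + 2) + 2)

theorem runs_efxCmd {B L K n m D : ℕ} {s : State} (hn : 1 ≤ n) (hn8 : n ≤ 8) (hB : 5 ≤ B)
    (hnL : n + 1 ≤ L) (hmL : m + 1 ≤ L) (hnmL : n * m ≤ L) (hLB : L < 2 ^ B)
    (hK : candidateCount n m ≤ K) (hKB : K < 2 ^ B) (h0 : s.reg 0 = n) (h1 : s.reg 1 = m)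
    (hpos : ∀ a < n * m, 1 ≤ s.arr 1 a) (hD : D = ∏ a ∈ Finset.range (n * m), s.arr 1 a)
    (hDB : D < 2 ^ B) (hwB : ∀ a < n * m, s.arr 0 a * (D / s.arr 1 a) < 2 ^ B)
    (hsum : ∀ i < n, ∑ u ∈ Finset.range m,
      s.arr 0 (i * m + u) * (D / s.arr 1 (i * m + u)) < 2 ^ B) :
    Runs B efxCmd s (efxTime L K) fun s' =>
      IsGood n m (fun a => s.arr 0 a * (D / s.arr 1 a)) m (s'.arr 2) := by
  refine .seq ((runs_prepareCmd (by omega) hnmL (by omega) (by omega) h0 h1 hpos hD hDB hwB).mono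
    le_rfl ?_)
  rintro s₁ ⟨hf₁, h3, h4⟩
  have hidx : ∀ i < n, ∀ u < m, i * m + u < n * m := fun i hi u hu => by nlinarith
  have hsum' : ∀ i < n, ∑ u ∈ Finset.range m, s₁.arr 3 (i * m + u) < 2 ^ B := by
    intro i hi
    rw [Finset.sum_congr rfl fun u hu => h3 _ (hidx i hi u (Finset.mem_range.1 hu))]
    exact hsum i hi
  have hreg : ∀ {s'}, s₁.SameOutside [4, 5, 6, 7, 8, 9] [2, 4, 5, 6] s' → s'.reg 0 = n ∧
      s'.reg 1 = m ∧ s'.arr 3 = s₁.arr 3 := fun h =>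
    ⟨(h.1 0 (by decide)).trans ((hf₁.1 0 (by decide)).trans h0),
      (h.1 1 (by decide)).trans ((hf₁.1 1 (by decide)).trans h1), h.2 3 (by decide)⟩
  refine .forLoop (n := m + 1) (fun r s' => s₁.SameOutside [4, 5, 6, 7, 8, 9] [2, 4, 5, 6] s' ∧
    (∀ u < m, s'.arr 4 u ≤ n) ∧ (r = 0 → ∀ u < m, s'.arr 4 u = n) ∧
    ∀ r', r = r' + 1 → IsGood n m (s₁.arr 3) r' (s'.arr 4) ∧ ∀ u < m, s'.arr 4 u = s'.arr 2 u)
    (by omega) hmL ?_ ?_ ?_ ?_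
  · exact ⟨State.sameOutside_setReg (by decide) _ _, by simpa using fun u hu => (h4 u hu).le,
      fun _ => by simpa using h4, fun r' hr' => by omega⟩
  · rintro r s' - ⟨hf, -⟩ -
    simp [succGoods, Expr.val, hreg hf]
  · rintro r s' hr ⟨hf, hle, hzero, hsucc⟩ hr4
    obtain ⟨hr0, hr1, ha3⟩ := hreg hf
    obtain ⟨c₀, hc₀, hgood⟩ : ∃ c < candidateCount n m,
        IsGood n m (s'.arr 3) (s'.reg 4) (candidate n m (s'.arr 4) c) := by
      rw [ha3, hr4]
      cases r with
      | zero =>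
        obtain ⟨c, hc, h⟩ := exists_candidate_isGood_zero (m := m) hn hn8 (s₁.arr 3)
        exact ⟨c, hc, h _ (hzero rfl)⟩
      | succ r => exact exists_candidate_isGood_succ hn (by omega) (hsucc r rfl).1
    refine (runs_roundCmd hn hB hnL (by omega) (by omega) hKB hr0 hr1 hle (by rwa [ha3])
      (hc₀.trans_le hK) hgood).mono le_rfl ?_
    rintro s'' ⟨hf', hle', heq, hgood'⟩
    rw [ha3, hr4] at hgood'
    refine ⟨(hf'.1 4 (by decide)).trans hr4, (hf.trans (hf'.mono (by decide) (by decide))).trans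
      (State.sameOutside_setReg (by decide) _ _), ?_, fun h => absurd h r.succ_ne_zero, ?_⟩
    · intro u hu
      simpa [heq u hu] using hle' u hu
    · intro r' hr'
      obtain rfl : r = r' := by omega
      exact ⟨hgood'.congr fun u hu => by simp [heq u hu], by simpa using heq⟩
  · rintro s' ⟨hf, -, -, hsucc⟩
    obtain ⟨hg, heq⟩ := hsucc m rfl
    refine IsGood.congr (w := fun a => s.arr 0 a * (D / s.arr 1 a)) (σ := s'.arr 4) ?_ heq
    have howned : ∀ σ, ∀ i < n, ∀ j, ownedWeight m (s₁.arr 3) σ i j =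
        ownedWeight m (fun a => s.arr 0 a * (D / s.arr 1 a)) σ i j := by
      intro σ i hi j
      refine Finset.sum_congr rfl fun u hu => ?_
      rw [h3 _ (hidx i hi u (Finset.mem_range.1 hu))]
    intro i hi u hu
    have := hg i hi u hu
    rwa [IsGoodAt, howned _ i hi, howned _ i hi, h3 _ (hidx i hi u hu)] at this

/-! ### Instances with rational values -/

section Instances

variable {n m : ℕ} (v : Fin n → Fin m → ℚ≥0)

/-- The product of all denominators. -/
def commonDenom : ℕ := ∏ a ∈ Finset.range (n * m), (initialState v).arr 1 a

/-- The values, multiplied by the product of all denominators, in the order of the input. -/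
def scaledWeight (a : ℕ) : ℕ :=
  (initialState v).arr 0 a * (commonDenom v / (initialState v).arr 1 a)

theorem initialState_arr_zero {a : ℕ} (h : a < n * m) :
    (initialState v).arr 0 a = (v (Fin.divNat ⟨a, h⟩) (Fin.modNat ⟨a, h⟩)).num := by
  simp [initialState, h]

theorem initialState_arr_one {a : ℕ} (h : a < n * m) :
    (initialState v).arr 1 a = (v (Fin.divNat ⟨a, h⟩) (Fin.modNat ⟨a, h⟩)).den := by
  simp [initialState, h]

theorem size_add_size_add_sum_range :
    Nat.size n + Nat.size m + ∑ a ∈ Finset.range (n * m),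
      (Nat.size ((initialState v).arr 0 a) + Nat.size ((initialState v).arr 1 a)) =
      instanceSize v := by
  rw [instanceSize, Finset.sum_range, ← Fintype.sum_prod_type', ← finProdFinEquiv.symm.sum_comp]
  congr 1
  refine Finset.sum_congr rfl fun a _ => ?_
  rw [initialState_arr_zero v a.2, initialState_arr_one v a.2]
  rfl

theorem one_le_arr_one {a : ℕ} (h : a < n * m) : 1 ≤ (initialState v).arr 1 a := by
  rw [initialState_arr_one v h]
  exact NNRat.den_pos _

theorem mul_le_instanceSize : n * m ≤ instanceSize v := by
  have h : ∑ a ∈ Finset.range (n * m), 1 ≤ ∑ a ∈ Finset.range (n * m),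
      (Nat.size ((initialState v).arr 0 a) + Nat.size ((initialState v).arr 1 a)) := by
    refine Finset.sum_le_sum fun a ha => ?_
    have := Nat.size_pos.2 (one_le_arr_one v (Finset.mem_range.1 ha))
    omega
  rw [Finset.sum_const, Finset.card_range, smul_eq_mul, mul_one] at h
  have := size_add_size_add_sum_range v
  omega

theorem lt_two_pow_instanceSize {x : ℕ} (h : Nat.size x ≤ instanceSize v) :
    x < 2 ^ instanceSize v := Nat.size_le.1 h

theorem goods_lt : m < 2 ^ instanceSize v :=
  lt_two_pow_instanceSize v (by unfold instanceSize; omega)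

theorem agents_lt : n < 2 ^ instanceSize v :=
  lt_two_pow_instanceSize v (by unfold instanceSize; omega)

theorem entry_size_le {a : ℕ} (h : a < n * m) :
    Nat.size ((initialState v).arr 0 a) + Nat.size ((initialState v).arr 1 a) ≤ instanceSize v := by
  have h1 := Finset.single_le_sum (f := fun a => Nat.size ((initialState v).arr 0 a) +
    Nat.size ((initialState v).arr 1 a)) (fun _ _ => Nat.zero_le _) (Finset.mem_range.2 h)
  have h2 := size_add_size_add_sum_range v
  omega

theorem bounded_initialState : (initialState v).Bounded (instanceSize v) := by
  refine ⟨fun r => ?_, fun k a => ?_⟩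
  · have h1 := goods_lt v
    have h2 := agents_lt v
    simp only [initialState]
    split_ifs
    · exact h2
    · exact h1
    · positivity
  · by_cases h : a < n * m
    · have := entry_size_le v h
      by_cases h0 : k = 0
      · subst h0
        exact lt_two_pow_instanceSize v (by omega)
      · by_cases h1 : k = 1
        · subst h1
          exact lt_two_pow_instanceSize v (by omega)
        · simp [initialState, h0, h1]
    · simp [initialState, h]

theorem commonDenom_le : commonDenom v ≤ 2 ^ instanceSize v := by
  have h1 : commonDenom v ≤
      ∏ a ∈ Finset.range (n * m), 2 ^ Nat.size ((initialState v).arr 1 a) :=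
    Finset.prod_le_prod' fun a _ => (Nat.lt_size_self _).le
  rw [Finset.prod_pow_eq_pow_sum] at h1
  refine h1.trans (Nat.pow_le_pow_right (by norm_num) ?_)
  rw [← size_add_size_add_sum_range v, Finset.sum_add_distrib]
  omega

theorem scaledWeight_le (a : ℕ) : scaledWeight v a ≤ 2 ^ (2 * instanceSize v) := by
  rw [two_mul, pow_add]
  exact Nat.mul_le_mul ((bounded_initialState v).2 0 a).le
    ((Nat.div_le_self _ _).trans (commonDenom_le v))

theorem sum_scaledWeight_le (i : ℕ) :
    ∑ u ∈ Finset.range m, scaledWeight v (i * m + u) ≤ 2 ^ (3 * instanceSize v) := by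
  refine (Finset.sum_le_card_nsmul _ _ _ fun u _ => scaledWeight_le v _).trans ?_
  rw [Finset.card_range, smul_eq_mul, show 3 * instanceSize v =
    instanceSize v + 2 * instanceSize v by ring, pow_add]
  exact Nat.mul_le_mul_right _ (goods_lt v).le

theorem weightValue_scaledWeight (i : Fin n) (g : Fin m) :
    weightValue n m (scaledWeight v) i g = commonDenom v * (v i g : ℝ) := by
  have ha : i * m + g < n * m := by
    have := i.2
    have := g.2
    nlinarith
  have he : finProdFinEquiv (i, g) = ⟨i * m + g, ha⟩ := Fin.ext (by simp; ring)
  have he' : (Fin.divNat ⟨i * m + g, ha⟩, Fin.modNat ⟨i * m + g, ha⟩) = (i, g) := by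
    rw [← he]
    exact finProdFinEquiv.symm_apply_apply (i, g)
  obtain ⟨hi, hg⟩ := Prod.mk.inj he'
  have h1 := one_le_arr_one v ha
  have hdvd : (initialState v).arr 1 (i * m + g) ∣ commonDenom v :=
    Finset.dvd_prod_of_mem _ (Finset.mem_range.2 ha)
  rw [weightValue, scaledWeight]
  push_cast [Nat.cast_div hdvd (by positivity : ((initialState v).arr 1 (i * m + g) : ℝ) ≠ 0)]
  rw [initialState_arr_zero v ha, initialState_arr_one v ha, hi, hg, NNRat.cast_def (v i g)]
  ring

theorem bundleValue_scaledWeight (i : Fin n) (S : Finset (Fin m)) :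
    bundleValue (weightValue n m (scaledWeight v)) i S =
      commonDenom v * bundleValue (fun i g => (v i g : ℝ)) i S := by
  simp only [bundleValue, weightValue_scaledWeight, Finset.mul_sum]

theorem commonDenom_pos : 0 < commonDenom v :=
  Finset.prod_pos fun _ ha => one_le_arr_one v (Finset.mem_range.1 ha)

/-- Every table of owners that passes the last test solves the instance. -/
theorem isAllocation_and_isEFX_of_isGood (hn : 1 ≤ n) {σ : ℕ → ℕ}
    (h : IsGood n m (scaledWeight v) m σ) : IsAllocation (ownerBundles n m σ) ∧
      IsEFX (2 / 3) (fun i g => ((v i g : ℚ≥0) : ℝ)) (ownerBundles n m σ) := by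
  obtain ⟨h1, h2⟩ := (isGood_iff hn).1 h
  refine ⟨⟨isPartialAllocation_ownerBundles n m σ, fun g => ?_⟩,
    isEFX_two_thirds_iff.2 fun k j hkj g hg => ?_⟩
  · by_contra! hg
    exact absurd (h2 g hg).1 (not_le.2 g.2)
  · have h3 := h1 k j hkj g hg
    rw [bundleValue_scaledWeight, bundleValue_scaledWeight] at h3
    have h4 : (0 : ℝ) < commonDenom v := Nat.cast_pos.2 (commonDenom_pos v)
    refine le_of_mul_le_mul_left ?_ h4
    linarith

end Instances

theorem candidateCount_le {n m N : ℕ} (hn8 : n ≤ 8) (hm : m ≤ N) :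
    candidateCount n m ≤ 8 ^ 8 * ((N + 1) * 8) ^ 27 := by
  refine Nat.mul_le_mul ?_ (Nat.pow_le_pow_left (Nat.mul_le_mul (by omega) hn8) 27)
  exact (Nat.pow_le_pow_left hn8 n).trans (Nat.pow_le_pow_right (by norm_num) hn8)

/-- The number of candidates is at most `2 ^ (24 + 27 * (N + 3))`. -/
theorem search_bound_lt (N : ℕ) : 8 ^ 8 * ((N + 1) * 8) ^ 27 < 2 ^ (100 * N + 1000) := by
  have h1 : N + 1 ≤ 2 ^ N := Nat.lt_two_pow_self
  calc 8 ^ 8 * ((N + 1) * 8) ^ 27 ≤ 8 ^ 8 * (2 ^ N * 8) ^ 27 := by gcongr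
    _ = 2 ^ (24 + (N + 3) * 27) := by
      rw [pow_add, pow_mul, pow_add]
      norm_num
    _ < 2 ^ (100 * N + 1000) := Nat.pow_lt_pow_right (by norm_num) (by omega)

/-- A polynomial that bounds the running time: `efxTime` steps with numbers of at most
`100 * N + 1000` bits, where `N` is the bit length of the instance. -/
theorem exists_polynomial_efxTime : ∃ p : Polynomial ℕ, ∀ N : ℕ,
    p.eval N = efxTime (N + 10) (8 ^ 8 * ((N + 1) * 8) ^ 27) *
      (5000 * ((100 * N + 1000) + 1)) := by
  have hc : ∃ p : Polynomial ℕ, ∀ N, p.eval N = candidateTime (N + 10) := by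
    refine ⟨(1 + (((.X + 10) * (1 + 1 + 2) + 2) + (1 + (((.X + 10) * (1 + 2) + 2) +
      (27 * (1 + 1 + 2) + 2))))) + ((1 + ((.X + 10) * ((((.X + 10) * (1 + 2) + 2) +
      (((.X + 10) * (1 + 2) + 2) + ((.X + 10) * (1 + 1 + 2) + 2))) + 2) + 2)) + 1), fun N => ?_⟩
    simp [candidateTime]
  obtain ⟨pc, hpc⟩ := hc
  refine ⟨((1 + (((.X + 10) * (1 + 2) + 2) + (((.X + 10) * (1 + 2) + 2) +
    ((.X + 10) * (1 + 2) + 2)))) + ((.X + 10) * (((1 + (1 + (8 ^ 8 * ((.X + 1) * 8) ^ 27 *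
    (pc + 1) + 1))) + ((.X + 10) * (1 + 2) + 2)) + 2) + 2)) *
    (5000 * ((100 * .X + 1000) + 1)), fun N => ?_⟩
  simp [efxTime, roundTime, hpc]

end FairDivision

theorem mainTheorem3 :
    -- existence, for arbitrary real values
    (∀ n m : ℕ, 1 ≤ n → n ≤ 8 → ∀ v : Fin n → Fin m → ℝ, (∀ i g, 0 ≤ v i g) →
      ∃ X : Fin n → Finset (Fin m),
        FairDivision.IsAllocation X ∧ FairDivision.IsEFX (2 / 3) v X) ∧
    -- one program computes such an allocation, in time polynomial in the bit length of the input
    (∃ (prog : RAM.Cmd) (p : Polynomial ℕ),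
      ∀ n m : ℕ, 1 ≤ n → n ≤ 8 → ∀ v : Fin n → Fin m → ℚ≥0,
        ∃ (s : RAM.State) (t : ℕ) (X : Fin n → Finset (Fin m)),
          RAM.Exec prog (FairDivision.initialState v) s t ∧
          t ≤ p.eval (FairDivision.instanceSize v) ∧
          FairDivision.Encodes s X ∧
          FairDivision.IsAllocation X ∧
          FairDivision.IsEFX (2 / 3) (fun i g => ((v i g : ℚ≥0) : ℝ)) X) := by
  constructor
  · intro n m hn hn8 v hv
    have : Nonempty (Fin n) := ⟨⟨0, hn⟩⟩
    obtain ⟨X, hX, hE⟩ := FairDivision.exists_isTwoThirdsEFX hv (by simpa using hn8)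
    exact ⟨X, hX, FairDivision.isEFX_two_thirds_iff.2 hE⟩
  · obtain ⟨p, hp⟩ := FairDivision.exists_polynomial_efxTime
    refine ⟨FairDivision.efxCmd, p, fun n m hn hn8 v => ?_⟩
    have hnm := FairDivision.mul_le_instanceSize v
    have hm : m ≤ n * m := Nat.le_mul_of_pos_left m hn
    have hlt : ∀ {a x : ℕ}, a < 100 * FairDivision.instanceSize v + 1000 → x ≤ 2 ^ a →
        x < 2 ^ (100 * FairDivision.instanceSize v + 1000) := fun ha hx =>
      hx.trans_lt (Nat.pow_lt_pow_right (by norm_num) ha)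
    have hbounded := FairDivision.bounded_initialState v
    obtain ⟨s, t, hexec, ht, -, hgood⟩ := FairDivision.runs_efxCmd
      (B := 100 * FairDivision.instanceSize v + 1000) (L := FairDivision.instanceSize v + 10)
      (s := FairDivision.initialState v) (m := m) hn hn8 (by omega) (by omega) (by omega) (by omega)
      (hlt (a := FairDivision.instanceSize v + 10) (by omega) Nat.lt_two_pow_self.le)
      (FairDivision.candidateCount_le hn8 (hm.trans hnm)) (FairDivision.search_bound_lt _)
      rfl rfl (fun a ha => FairDivision.one_le_arr_one v ha) rfl
      (hlt (by omega) (FairDivision.commonDenom_le v))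
      (fun a _ => hlt (by omega) (FairDivision.scaledWeight_le v a))
      (fun i _ => hlt (by omega) (FairDivision.sum_scaledWeight_le v i))
      ⟨fun r => hlt (by omega) (hbounded.1 r).le, fun k a => hlt (by omega) (hbounded.2 k a).le⟩
    obtain ⟨hX, hE⟩ := FairDivision.isAllocation_and_isEFX_of_isGood v hn hgood
    exact ⟨s, t, FairDivision.ownerBundles n m (s.arr 2), hexec, by rwa [hp],
      fun i g => FairDivision.mem_ownerBundles, hX, hE⟩
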